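/- All graphs are finite, simple and undirected. An edge dominating set of a graph $G=(V,E)$ is a set $M\subseteq E$ such that every edge of $E\setminus M$ shares an endpoint with some edge of $M$; it is minimal if no proper subset of $M$ is an edge dominating set of $G$. In the problem Upper EDS the input is a graph $G$ and a non-negative integer $k$, and the question is whether $G$ has a minimal edge dominating set with at least $k$ edges. Upper EDS can be solved in time $2^{O(k)}\cdot n^{O(1)}$, where $n=|V(G)|$. That is, there are a constant $c$ and a single program of a random access machine (unit cost, with addition and truncated subtraction as its only arithmetic; the input is $n$, $k$ and the adjacency matrix of $G$) which, on every input $(G,k)$, halts after at most $2^{ck}\cdot c\,(n+1)^{c}$ steps and correctly answers whether $(G,k)$ is a yes-instance. Moreover, for every graph $G$, every integer $k\ge 0$ and every inclusion-wise maximal matching $M$ of $G$, the set $M$ is a minimal edge dominating set of $G$, and: (i) if $|M|\ge k$, then $(G,k)$ is a yes-instance; (ii) if $|M|<k$, then the endpoints of the edges of $M$ form a vertex cover of $G$ of size at most $2k-2$, and $G$ has a tree decomposition of width at most $2k-1$. -/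

import Mathlib

namespace UpperEDS

/-! ### The problem -/

/-- `M` is an edge dominating set of `G`: a set of edges of `G` such that every edge of `G`
outside `M` shares an endpoint with an edge of `M`. -/
def IsEdgeDominating {V : Type*} (G : SimpleGraph V) (M : Set (Sym2 V)) : Prop :=
  M ⊆ G.edgeSet ∧ ∀ e ∈ G.edgeSet \ M, ∃ f ∈ M, ∃ v, v ∈ e ∧ v ∈ f

/-- `M` is an inclusion-wise minimal edge dominating set of `G`. -/
def IsMinimalEdgeDominating {V : Type*} (G : SimpleGraph V) (M : Set (Sym2 V)) : Prop :=
  Minimal (IsEdgeDominating G) M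

/-- `(G, k)` is a yes-instance of Upper EDS. -/
def IsYes {V : Type*} [Finite V] (G : SimpleGraph V) (k : ℕ) : Prop :=
  ∃ M : Set (Sym2 V), IsMinimalEdgeDominating G M ∧ k ≤ M.ncard

/-- A tree decomposition of `G` whose tree has node set `T`. -/
structure TreeDecomposition {V : Type*} (G : SimpleGraph V) (T : Type*) where
  /-- The tree. -/
  tree : SimpleGraph T
  isTree : tree.IsTree
  /-- The bags. -/
  bag : T → Set V
  iUnion_bag : ⋃ t, bag t = Set.univ
  exists_bag_of_adj : ∀ u v, G.Adj u v → ∃ t, {u, v} ⊆ bag t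
  /-- If `t` lies on the path of the tree from `t₁` to `t₂`, then `bag t` contains
  `bag t₁ ∩ bag t₂`. -/
  interpolation : ∀ (t₁ t₂ : T) (p : tree.Walk t₁ t₂), p.IsPath →
    ∀ t ∈ p.support, bag t₁ ∩ bag t₂ ⊆ bag t

/-- The width of `D`, the maximum of `|X_t| - 1` over the bags `X_t`, is at most `w`. -/
def TreeDecomposition.WidthLE {V : Type*} [Finite V] {G : SimpleGraph V} {T : Type*}
    (D : TreeDecomposition G T) (w : ℤ) : Prop :=
  ∀ t, ((D.bag t).ncard : ℤ) - 1 ≤ w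

/-! ### The machine model

A random access machine with structured control flow. Its storage consists of registers, addressed
by constants of the program, and of a memory, addressed indirectly through registers; each holds
one natural number per cell. Every elementary instruction and every test costs one step.
The only arithmetic is addition and truncated subtraction, so one step lengthens the numbers
by at most one bit, and the model is polynomially equivalent to Turing machines. -/

/-- A state of the machine. -/
structure State where
  /-- The registers. -/
  reg : ℕ → ℕ
  /-- The memory. -/
  mem : ℕ → ℕ

/-- `s` with register `r` set to `x`. -/
def State.setReg (s : State) (r x : ℕ) : State :=
  { s with reg := Function.update s.reg r x }

/-- `s` with memory cell `i` set to `x`. -/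
def State.setMem (s : State) (i x : ℕ) : State :=
  { s with mem := Function.update s.mem i x }

/-- Programs of the machine; all arguments of type `ℕ` are register names,
except the second argument of `const`, which is a literal. -/
inductive Prog : Type
  /-- do nothing -/
  | skip : Prog
  /-- `reg r := x` for the literal `x` -/
  | const (r x : ℕ) : Prog
  /-- `reg r := reg a` -/
  | copy (r a : ℕ) : Prog
  /-- `reg r := reg a + reg b` -/
  | add (r a b : ℕ) : Prog
  /-- `reg r := max (reg a - reg b) 0` -/
  | sub (r a b : ℕ) : Prog
  /-- `reg r := mem (reg a)` -/
  | load (r a : ℕ) : Prog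
  /-- `mem (reg a) := reg b` -/
  | store (a b : ℕ) : Prog
  /-- first `p`, then `q` -/
  | seq (p q : Prog) : Prog
  /-- if `reg r ≠ 0` then `p` else `q` -/
  | cond (r : ℕ) (p q : Prog) : Prog
  /-- while `reg r ≠ 0` do `p` -/
  | loop (r : ℕ) (p : Prog) : Prog

/-- `Exec p s t s'`: the program `p`, started in state `s`, halts after exactly `t` steps
in state `s'`. -/
inductive Exec : Prog → State → ℕ → State → Prop
  | skip (s : State) : Exec .skip s 1 s
  | const (s : State) (r x : ℕ) : Exec (.const r x) s 1 (s.setReg r x)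
  | copy (s : State) (r a : ℕ) : Exec (.copy r a) s 1 (s.setReg r (s.reg a))
  | add (s : State) (r a b : ℕ) : Exec (.add r a b) s 1 (s.setReg r (s.reg a + s.reg b))
  | sub (s : State) (r a b : ℕ) : Exec (.sub r a b) s 1 (s.setReg r (s.reg a - s.reg b))
  | load (s : State) (r a : ℕ) : Exec (.load r a) s 1 (s.setReg r (s.mem (s.reg a)))
  | store (s : State) (a b : ℕ) : Exec (.store a b) s 1 (s.setMem (s.reg a) (s.reg b))
  | seq {p q : Prog} {s s₁ s₂ : State} {t₁ t₂ : ℕ} (hp : Exec p s t₁ s₁)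
      (hq : Exec q s₁ t₂ s₂) : Exec (.seq p q) s (t₁ + t₂) s₂
  | cond_true {r : ℕ} {p q : Prog} {s s₁ : State} {t : ℕ} (hr : s.reg r ≠ 0)
      (hp : Exec p s t s₁) : Exec (.cond r p q) s (t + 1) s₁
  | cond_false {r : ℕ} {p q : Prog} {s s₁ : State} {t : ℕ} (hr : s.reg r = 0)
      (hq : Exec q s t s₁) : Exec (.cond r p q) s (t + 1) s₁
  | loop_done {r : ℕ} {p : Prog} {s : State} (hr : s.reg r = 0) : Exec (.loop r p) s 1 s
  | loop_step {r : ℕ} {p : Prog} {s s₁ s₂ : State} {t₁ t₂ : ℕ} (hr : s.reg r ≠ 0)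
      (hp : Exec p s t₁ s₁) (hl : Exec (.loop r p) s₁ t₂ s₂) :
      Exec (.loop r p) s (t₁ + t₂ + 1) s₂

open Classical in
/-- The input `(G, k)`, where `G` has vertices `0, …, n - 1`: register `0` holds `n`,
register `1` holds `k`, the memory holds the adjacency matrix of `G` row by row
(cell `n * u + v` is `1` if `u` and `v` are adjacent and `0` otherwise),
and everything else is `0`. -/
noncomputable def input {n : ℕ} (G : SimpleGraph (Fin n)) (k : ℕ) : State where
  reg r := if r = 0 then n else if r = 1 then k else 0
  mem i := if ∃ u v : Fin n, i = n * (u : ℕ) + (v : ℕ) ∧ G.Adj u v then 1 else 0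

/-- On every input `(G, k)`, the program `p` halts after at most `f n k` steps, `n` being the number
of vertices of `G`, with `1` in register `0` if `(G, k)` is a yes-instance of Upper EDS
and with `0` in register `0` otherwise. -/
def SolvesInTime (p : Prog) (f : ℕ → ℕ → ℕ) : Prop :=
  ∀ (n : ℕ) (G : SimpleGraph (Fin n)) (k : ℕ), ∃ (t : ℕ) (s : State),
    Exec p (input G k) t s ∧ t ≤ f n k ∧
      (IsYes G k → s.reg 0 = 1) ∧ (¬ IsYes G k → s.reg 0 = 0)

end UpperEDS

/-! An edge dominating set is minimal iff each member `e` has a private edge, one that meets no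
other member (`isMinimalEdgeDominating_iff`). If `e = uv` and `u` lies on a further member, the
private edge must avoid `u`; so it joins `v` to an uncovered vertex, and `v` lies on no further
member. Minimal edge dominating sets are therefore star forests whose uncovered vertices are
independent and in which every leaf of a proper star has an uncovered neighbour. `StarForest`
records this by a type for each vertex and a map `π`; `exists_starForest` and `StarForest.isYes`
translate back and forth, the number of edges being half the sum of `gain`.

An edge of a matching is its own private edge, so a maximal matching is a minimal edge dominating
set and settles the question if it has `k` edges. Otherwise its endpoints form a vertex cover `C`
with at most `2 * k - 2` vertices, and a tree whose bags are `C` plus at most one vertex is a tree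
decomposition.

For the algorithm a greedy maximal matching is computed and, if it is small, star forests are
searched by scanning the vertices. The types of the vertices of `C` are guessed beforehand. Every
edge has an end in `C`, so seven bits for each vertex of `C` and a counter up to `2 * n` are all
that must be remembered (`exists_starForest_of_scan`, `exists_scan_of_starForest`). This leaves at
most `(2 * n + 1) * 2 ^ (14 * k)` codes per vertex, and `exists_table_iff_isYes` shows that the
dynamic program over these codes is correct.

For the running time, all cells of the tables are written in a calculus of functions closed under
bounded sums (`Comp`), and `Comp.fill` fills a table with such a function. Everything takes time
polynomial in `(n + 1) * 2 ^ (14 * k)`, which has the form required. -/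

namespace UpperEDS

/-! ### Running programs -/

/-- Started in `s`, the program `p` halts after at most `T` steps in a state satisfying `Q`. -/
def Runs (p : Prog) (s : State) (T : ℕ) (Q : State → Prop) : Prop :=
  ∃ t s', Exec p s t s' ∧ t ≤ T ∧ Q s'

theorem Runs.mono {p : Prog} {s : State} {T T' : ℕ} {Q Q' : State → Prop} (h : Runs p s T Q)
    (hT : T ≤ T') (hQ : ∀ s', Q s' → Q' s') : Runs p s T' Q' := by
  obtain ⟨t, s', h1, h2, h3⟩ := h
  exact ⟨t, s', h1, h2.trans hT, hQ _ h3⟩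

theorem Runs.seq {p q : Prog} {s : State} {T T' : ℕ} {Q Q' : State → Prop} (h : Runs p s T Q)
    (h' : ∀ s', Q s' → Runs q s' T' Q') : Runs (.seq p q) s (T + T') Q' := by
  obtain ⟨t, s', h1, h2, h3⟩ := h
  obtain ⟨t', s'', h1', h2', h3'⟩ := h' s' h3
  exact ⟨_, s'', .seq h1 h1', by omega, h3'⟩

theorem Runs.const {s : State} {r x : ℕ} {Q : State → Prop} (h : Q (s.setReg r x)) :
    Runs (.const r x) s 1 Q := ⟨_, _, .const s r x, le_rfl, h⟩

theorem Runs.copy {s : State} {r a : ℕ} {Q : State → Prop} (h : Q (s.setReg r (s.reg a))) :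
    Runs (.copy r a) s 1 Q := ⟨_, _, .copy s r a, le_rfl, h⟩

theorem Runs.add {s : State} {r a b : ℕ} {Q : State → Prop}
    (h : Q (s.setReg r (s.reg a + s.reg b))) : Runs (.add r a b) s 1 Q :=
  ⟨_, _, .add s r a b, le_rfl, h⟩

theorem Runs.sub {s : State} {r a b : ℕ} {Q : State → Prop}
    (h : Q (s.setReg r (s.reg a - s.reg b))) : Runs (.sub r a b) s 1 Q :=
  ⟨_, _, .sub s r a b, le_rfl, h⟩

theorem Runs.load {s : State} {r a : ℕ} {Q : State → Prop}
    (h : Q (s.setReg r (s.mem (s.reg a)))) : Runs (.load r a) s 1 Q :=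
  ⟨_, _, .load s r a, le_rfl, h⟩

theorem Runs.store {s : State} {a b : ℕ} {Q : State → Prop}
    (h : Q (s.setMem (s.reg a) (s.reg b))) : Runs (.store a b) s 1 Q :=
  ⟨_, _, .store s a b, le_rfl, h⟩

theorem Runs.const_seq {s : State} {r x T : ℕ} {q : Prog} {Q : State → Prop}
    (h : Runs q (s.setReg r x) T Q) : Runs (.seq (.const r x) q) s (1 + T) Q :=
  Runs.seq (Runs.const (Q := fun t => t = _) rfl) fun _ e => e ▸ h

theorem Runs.add_seq {s : State} {r a b T : ℕ} {q : Prog} {Q : State → Prop}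
    (h : Runs q (s.setReg r (s.reg a + s.reg b)) T Q) : Runs (.seq (.add r a b) q) s (1 + T) Q :=
  Runs.seq (Runs.add (Q := fun t => t = _) rfl) fun _ e => e ▸ h

theorem Runs.store_seq {s : State} {a b T : ℕ} {q : Prog} {Q : State → Prop}
    (h : Runs q (s.setMem (s.reg a) (s.reg b)) T Q) : Runs (.seq (.store a b) q) s (1 + T) Q :=
  Runs.seq (Runs.store (Q := fun t => t = _) rfl) fun _ e => e ▸ h

/-- A loop whose control register counts down. -/
theorem Runs.loop {p : Prog} {r n T : ℕ} {I : ℕ → State → Prop}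
    (hr : ∀ i s, i ≤ n → I i s → s.reg r = n - i)
    (hp : ∀ i s, i < n → I i s → Runs p s T (I (i + 1))) {s : State} (h : I 0 s) :
    Runs (.loop r p) s (n * (T + 1) + 1) (I n) := by
  suffices H : ∀ m i s, i + m = n → I i s → Runs (.loop r p) s (m * (T + 1) + 1) (I n) from
    H n 0 s (by omega) h
  intro m
  induction m with
  | zero =>
    intro i s hi hs
    obtain rfl : i = n := by omega
    exact ⟨1, s, .loop_done (by rw [hr i s le_rfl hs]; omega), by omega, hs⟩
  | succ m ih =>
    intro i s hi hs
    obtain ⟨t, s', h1, h2, h3⟩ := hp i s (by omega) hs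
    obtain ⟨t', s'', h1', h2', h3'⟩ := ih (i + 1) s' (by omega) h3
    refine ⟨_, s'', .loop_step (by rw [hr i s (by omega) hs]; omega) h1 h1', ?_, h3'⟩
    rw [Nat.succ_mul]
    omega

@[simp] theorem State.setReg_reg (s : State) (r x r' : ℕ) :
    (s.setReg r x).reg r' = if r' = r then x else s.reg r' := by
  simp [State.setReg, Function.update_apply]

@[simp] theorem State.setReg_mem (s : State) (r x : ℕ) : (s.setReg r x).mem = s.mem := rfl

@[simp] theorem State.setMem_reg (s : State) (i x : ℕ) : (s.setMem i x).reg = s.reg := rfl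

@[simp] theorem State.setMem_mem (s : State) (i x : ℕ) :
    (s.setMem i x).mem = Function.update s.mem i x := rfl

/-! ### Contexts -/

/-- A context: a memory and finitely many variables, which a layout assigns to registers. -/
class Ctx (α : Type) where
  /-- the memory -/
  mem : α → ℕ → ℕ
  /-- replace the memory -/
  withMem : α → (ℕ → ℕ) → α
  /-- the assignments of variables to registers -/
  Lay : Type
  /-- read the context off a state -/
  dec : Lay → State → α
  /-- all registers used are below the given one -/
  Below : Lay → ℕ → Prop
  /-- all numbers in the context are at most the given one -/
  Le : α → ℕ → Prop
  below_mono : ∀ l L L', Below l L → L ≤ L' → Below l L'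
  le_mono : ∀ a B B', Le a B → B ≤ B' → Le a B'
  dec_withMem : ∀ l L s s', Below l L → (∀ r < L, s'.reg r = s.reg r) →
    dec l s' = withMem (dec l s) s'.mem
  withMem_mem : ∀ l s, withMem (dec l s) s.mem = dec l s
  mem_dec : ∀ l s, mem (dec l s) = s.mem
  mem_le : ∀ a B i, Le a B → mem a i ≤ B

instance : Ctx (ℕ → ℕ) where
  mem m := m
  withMem _ m := m
  Lay := Unit
  dec _ s := s.mem
  Below _ _ := True
  Le m B := ∀ i, m i ≤ B
  below_mono _ _ _ _ _ := trivial
  le_mono _ _ _ h h' i := (h i).trans h'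
  dec_withMem _ _ _ _ _ _ := rfl
  withMem_mem _ _ := rfl
  mem_dec _ _ := rfl
  mem_le _ _ i h := h i

/-- Extending a context by one variable is how the index of a sum, of a quantifier or of a table
enters the expression in its scope. -/
instance {α : Type} [Ctx α] : Ctx (α × ℕ) where
  mem a := Ctx.mem a.1
  withMem a m := (Ctx.withMem a.1 m, a.2)
  Lay := Ctx.Lay α × ℕ
  dec l s := (Ctx.dec l.1 s, s.reg l.2)
  Below l L := Ctx.Below l.1 L ∧ l.2 < L
  Le a B := Ctx.Le a.1 B ∧ a.2 ≤ B
  below_mono l L L' h h' := ⟨Ctx.below_mono _ _ _ h.1 h', h.2.trans_le h'⟩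
  le_mono a B B' h h' := ⟨Ctx.le_mono _ _ _ h.1 h', h.2.trans h'⟩
  dec_withMem l L s s' h h' := by
    rw [Ctx.dec_withMem l.1 L s s' h.1 h', h' _ h.2]
  withMem_mem l s := by rw [Ctx.withMem_mem]
  mem_dec l s := Ctx.mem_dec _ _
  mem_le a B i h := Ctx.mem_le _ _ _ h.1

/-! ### Functions computable in polynomial time. -/

section

variable {α : Type} [Ctx α]

theorem Ctx.dec_congr {l : Ctx.Lay α} {L : ℕ} {s s' : State} (h : Ctx.Below l L)
    (hm : s'.mem = s.mem) (hr : ∀ r < L, s'.reg r = s.reg r) : Ctx.dec l s' = Ctx.dec l s := by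
  rw [Ctx.dec_withMem l L s s' h hr, hm, Ctx.withMem_mem]

/-- `p` computes `f` into register `L`, leaving the memory and the registers below `L` alone. -/
def Computes (p : Prog) (f : α → ℕ) (l : Ctx.Lay α) (L K : ℕ) : Prop :=
  ∀ s B, Ctx.Le (Ctx.dec l s) B → Runs p s ((B + 2) ^ K) fun s' =>
    s'.mem = s.mem ∧ (∀ r < L, s'.reg r = s.reg r) ∧ s'.reg L = f (Ctx.dec l s)

/-- `f` is computable, in time and with values polynomial in the numbers in the context. -/
def Comp (f : α → ℕ) : Prop :=
  ∃ K, (∀ a B, Ctx.Le a B → f a ≤ (B + 2) ^ K) ∧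
    ∀ (l : Ctx.Lay α) (L : ℕ), Ctx.Below l L → ∃ p, Computes p f l L K

/-- As the base `B + 2` is at least `2`, constants, sums, products and compositions of bounds are
all absorbed by enlarging the exponent. Every bound on time and values is kept as a pure power of `B
+ 2`. -/
theorem le_two_pow_add (B c : ℕ) : c ≤ (B + 2) ^ c :=
  Nat.lt_two_pow_self.le.trans (Nat.pow_le_pow_left (by omega) _)

theorem le_pow_one (B : ℕ) : B ≤ (B + 2) ^ 1 := by rw [pow_one]; omega

theorem pow_add_pow_le (B a b : ℕ) : (B + 2) ^ a + (B + 2) ^ b ≤ (B + 2) ^ (a + b + 1) := by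
  have h1 : (B + 2) ^ a ≤ (B + 2) ^ (a + b) := Nat.pow_le_pow_right (by omega) (by omega)
  have h2 : (B + 2) ^ b ≤ (B + 2) ^ (a + b) := Nat.pow_le_pow_right (by omega) (by omega)
  calc _ ≤ (B + 2) ^ (a + b) * 2 := by omega
    _ ≤ (B + 2) ^ (a + b) * (B + 2) := Nat.mul_le_mul_left _ (by omega)
    _ = _ := (pow_succ _ _).symm

theorem add_le_pow {B x y a b : ℕ} (hx : x ≤ (B + 2) ^ a) (hy : y ≤ (B + 2) ^ b) :
    x + y ≤ (B + 2) ^ (a + b + 1) := (Nat.add_le_add hx hy).trans (pow_add_pow_le B a b)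

theorem mul_le_pow {B x y a b : ℕ} (hx : x ≤ (B + 2) ^ a) (hy : y ≤ (B + 2) ^ b) :
    x * y ≤ (B + 2) ^ (a + b) := (Nat.mul_le_mul hx hy).trans (pow_add _ _ _).ge

theorem pow_comp_le (B a b : ℕ) : ((B + 2) ^ a + 2) ^ b ≤ (B + 2) ^ ((a + 2) * b) := by
  rw [pow_mul]
  refine Nat.pow_le_pow_left ?_ b
  have h : 1 ≤ (B + 2) ^ a := Nat.one_le_pow _ _ (by omega)
  have h' : 4 ≤ (B + 2) ^ 2 := Nat.pow_le_pow_left (show 2 ≤ B + 2 by omega) 2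
  rw [pow_add]
  nlinarith

theorem pow_mono_right' {B x a b : ℕ} (hx : x ≤ (B + 2) ^ a) (h : a ≤ b) : x ≤ (B + 2) ^ b :=
  hx.trans (Nat.pow_le_pow_right (by omega) h)

theorem Comp.const (c : ℕ) : Comp (fun _ : α => c) := by
  refine ⟨c + 1, fun a B _ => pow_mono_right' (le_two_pow_add B c) (by omega), fun l L _ =>
    ⟨.const L c, fun s B _ => (Runs.const ?_).mono (Nat.one_le_pow _ _ (by omega)) fun _ h => h⟩⟩
  refine ⟨rfl, fun r hr => ?_, by simp⟩
  simp [hr.ne]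

theorem Comp.var : Comp (fun a : α × ℕ => a.2) := by
  refine ⟨1, fun a B h => h.2.trans (le_pow_one B), fun l L _ =>
    ⟨.copy L l.2, fun s B _ => (Runs.copy ?_).mono (Nat.one_le_pow _ _ (by omega)) fun _ h => h⟩⟩
  refine ⟨rfl, fun r hr => ?_, ?_⟩
  · simp [hr.ne]
  · simp [Ctx.dec]

theorem Comp.weaken {f : α → ℕ} (hf : Comp f) : Comp (fun a : α × ℕ => f a.1) := by
  obtain ⟨K, h1, h2⟩ := hf
  refine ⟨K, fun a B h => h1 _ _ h.1, fun l L hl => ?_⟩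
  obtain ⟨p, hp⟩ := h2 l.1 L hl.1
  exact ⟨p, fun s B h => hp s B h.1⟩

/-- Evaluate two functions into consecutive registers. -/
theorem Computes.pair {p q : Prog} {f g : α → ℕ} {l : Ctx.Lay α} {L K K' : ℕ}
    (hl : Ctx.Below l L) (hp : Computes p f l L K) (hq : Computes q g l (L + 1) K') (s : State)
    (B : ℕ) (h : Ctx.Le (Ctx.dec l s) B) :
    Runs (.seq p q) s ((B + 2) ^ K + (B + 2) ^ K') fun s' =>
      s'.mem = s.mem ∧ (∀ r < L, s'.reg r = s.reg r) ∧ s'.reg L = f (Ctx.dec l s) ∧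
        s'.reg (L + 1) = g (Ctx.dec l s) := by
  refine (hp s B h).seq fun s' ⟨h1, h2, h3⟩ => ?_
  have h4 := Ctx.dec_congr hl h1 h2
  refine (hq s' B (by rwa [h4])).mono le_rfl fun s'' ⟨h1', h2', h3'⟩ => ?_
  refine ⟨h1'.trans h1, fun r hr => (h2' r (by omega)).trans (h2 r hr), ?_, by rw [h3', h4]⟩
  rw [h2' L (by omega), h3]

theorem Comp.add {f g : α → ℕ} (hf : Comp f) (hg : Comp g) : Comp (fun a => f a + g a) := by
  obtain ⟨K, h1, h2⟩ := hf
  obtain ⟨K', h1', h2'⟩ := hg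
  refine ⟨(K + K' + 1) + 1 + 1, fun a B h =>
    pow_mono_right' (add_le_pow (h1 a B h) (h1' a B h)) (by omega), fun l L hl => ?_⟩
  obtain ⟨p, hp⟩ := h2 l L hl
  obtain ⟨q, hq⟩ := h2' l (L + 1) (Ctx.below_mono _ _ _ hl (by omega))
  refine ⟨.seq (.seq p q) (.add L L (L + 1)), fun s B h => ?_⟩
  refine Runs.mono ((hp.pair hl hq s B h).seq fun s' ⟨e1, e2, e3, e4⟩ => Runs.add
    (Q := fun s' => s'.mem = s.mem ∧ (∀ r < L, s'.reg r = s.reg r) ∧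
      s'.reg L = f (Ctx.dec l s) + g (Ctx.dec l s)) ?_)
    (add_le_pow (a := K + K' + 1) (pow_add_pow_le _ _ _) (le_two_pow_add B 1)) fun _ h => h
  refine ⟨e1, fun r hr => ?_, ?_⟩
  · simp [hr.ne, e2 r hr]
  · simp [e3, e4]

theorem Comp.sub {f g : α → ℕ} (hf : Comp f) (hg : Comp g) : Comp (fun a => f a - g a) := by
  obtain ⟨K, h1, h2⟩ := hf
  obtain ⟨K', h1', h2'⟩ := hg
  refine ⟨(K + K' + 1) + 1 + 1, fun a B h =>
    pow_mono_right' ((Nat.sub_le _ _).trans (h1 a B h)) (by omega), fun l L hl => ?_⟩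
  obtain ⟨p, hp⟩ := h2 l L hl
  obtain ⟨q, hq⟩ := h2' l (L + 1) (Ctx.below_mono _ _ _ hl (by omega))
  refine ⟨.seq (.seq p q) (.sub L L (L + 1)), fun s B h => ?_⟩
  refine Runs.mono ((hp.pair hl hq s B h).seq fun s' ⟨e1, e2, e3, e4⟩ => Runs.sub
    (Q := fun s' => s'.mem = s.mem ∧ (∀ r < L, s'.reg r = s.reg r) ∧
      s'.reg L = f (Ctx.dec l s) - g (Ctx.dec l s)) ?_)
    (add_le_pow (a := K + K' + 1) (pow_add_pow_le _ _ _) (le_two_pow_add B 1)) fun _ h => h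
  refine ⟨e1, fun r hr => ?_, ?_⟩
  · simp [hr.ne, e2 r hr]
  · simp [e3, e4]

theorem Comp.load {f : α → ℕ} (hf : Comp f) : Comp (fun a => Ctx.mem a (f a)) := by
  obtain ⟨K, h1, h2⟩ := hf
  refine ⟨K + 1 + 1, fun a B h => pow_mono_right' (a := 1) ((Ctx.mem_le a B _ h).trans (le_pow_one B))
    (by omega), fun l L hl => ?_⟩
  obtain ⟨p, hp⟩ := h2 l L hl
  refine ⟨.seq p (.load L L), fun s B h => ?_⟩
  refine Runs.mono ((hp s B h).seq fun s' ⟨e1, e2, e3⟩ => Runs.load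
    (Q := fun s' => s'.mem = s.mem ∧ (∀ r < L, s'.reg r = s.reg r) ∧
      s'.reg L = Ctx.mem (Ctx.dec l s) (f (Ctx.dec l s))) ?_)
    (add_le_pow le_rfl (le_two_pow_add B 1)) fun _ h => h
  refine ⟨e1, fun r hr => ?_, ?_⟩
  · simp [hr.ne, e2 r hr]
  · simp [e3, e1, Ctx.mem_dec]

/-- The only loop of the calculus: products, quotients and bounded quantifiers are all reduced to
it. -/
theorem Comp.sum {f : α → ℕ} {g : α → ℕ → ℕ} (hf : Comp f)
    (hg : Comp (fun a : α × ℕ => g a.1 a.2)) :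
    Comp (fun a => ∑ i ∈ Finset.range (f a), g a i) := by
  obtain ⟨K, h1, h2⟩ := hf
  obtain ⟨K', h1', h2'⟩ := hg
  -- The index may exceed `B`, but not the polynomial bound on `f`, so the summand is run with this
  -- larger bound.
  have hB : ∀ a B i, Ctx.Le a B → i < f a → Ctx.Le (a, i) ((B + 2) ^ (K + 1)) := fun a B i h hi =>
    ⟨Ctx.le_mono _ _ _ h ((le_pow_one B).trans
      (Nat.pow_le_pow_right (by omega) (by omega))),
      pow_mono_right' (hi.le.trans (h1 a B h)) (by omega)⟩
  refine ⟨K + (K + ((K + 1 + 2) * K' + 4 + 1) + 8 + 1) + 1, fun a B h => ?_, fun l L hl => ?_⟩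
  · refine pow_mono_right' (a := K + (K + 1 + 2) * K') ?_ (by omega)
    refine (Finset.sum_le_card_nsmul _ _ ((B + 2) ^ ((K + 1 + 2) * K')) fun i hi => ?_).trans ?_
    · exact (h1' (a, i) _ (hB a B i h (Finset.mem_range.1 hi))).trans (pow_comp_le _ _ _)
    · rw [Finset.card_range, smul_eq_mul]
      exact mul_le_pow (h1 a B h) le_rfl
  obtain ⟨p, hp⟩ := h2 l L hl
  have hl' : Ctx.Below (α := α × ℕ) (l, L + 2) (L + 4) :=
    ⟨Ctx.below_mono _ _ _ hl (by omega), by simp⟩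
  obtain ⟨q, hq⟩ := h2' (l, L + 2) (L + 4) hl'
  -- Register `L` counts down the remaining rounds, `L + 1` accumulates the sum, `L + 2` holds the
  -- index, `L + 3` the constant `1`, and `L + 4` receives the summand.
  refine ⟨.seq p (.seq (.const (L + 1) 0) (.seq (.const (L + 2) 0) (.seq (.const (L + 3) 1)
    (.seq (.loop L (.seq q (.seq (.add (L + 1) (L + 1) (L + 4))
      (.seq (.add (L + 2) (L + 2) (L + 3)) (.sub L L (L + 3)))))) (.copy L (L + 1)))))),
    fun s B h => ?_⟩
  set a := Ctx.dec l s with ha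
  let I : ℕ → State → Prop := fun i s' => s'.mem = s.mem ∧ (∀ r < L, s'.reg r = s.reg r) ∧
    s'.reg L = f a - i ∧ s'.reg (L + 1) = ∑ j ∈ Finset.range i, g a j ∧ s'.reg (L + 2) = i ∧
    s'.reg (L + 3) = 1
  have hloop : ∀ s', I 0 s' → Runs (.loop L (.seq q (.seq (.add (L + 1) (L + 1) (L + 4))
      (.seq (.add (L + 2) (L + 2) (L + 3)) (.sub L L (L + 3)))))) s'
      (f a * ((B + 2) ^ ((K + 1 + 2) * K') + (1 + (1 + 1)) + 1) + 1) (I (f a)) := by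
    intro s' hs'
    refine Runs.loop (fun i s hi hs => hs.2.2.1) (fun i s₁ hi hs₁ => ?_) hs'
    obtain ⟨e1, e2, e3, e4, e5, e6⟩ := hs₁
    have hd : Ctx.dec (α := α × ℕ) (l, L + 2) s₁ = (a, i) :=
      Prod.ext (Ctx.dec_congr hl e1 e2) e5
    refine Runs.seq (Q := fun s₂ => s₂.mem = s₁.mem ∧ (∀ r < L + 4, s₂.reg r = s₁.reg r) ∧
      s₂.reg (L + 4) = g a i) ?_ fun s₂ ⟨d1, d2, d3⟩ => ?_
    · have := hq s₁ ((B + 2) ^ (K + 1)) (by rw [hd]; exact hB a B i h hi)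
      rw [hd] at this
      exact this.mono (pow_comp_le _ _ _) fun _ h => h
    refine (Runs.add_seq (Runs.add_seq (T := 1) ?_)).mono le_rfl fun _ h => h
    refine Runs.sub ?_
    refine ⟨d1.trans e1, fun r hr => ?_, ?_, ?_, ?_, ?_⟩
    · simp [hr.ne, d2 r (by omega), e2 r hr, show r ≠ L + 1 by omega, show r ≠ L + 2 by omega]
    · simp [d2, e3, e6]
      omega
    · simp [d2, d3, e4, Finset.sum_range_succ]
    · simp [d2, e5, e6]
    · simp [d2, e6]
  have hrun : ∀ s₁, (s₁.mem = s.mem ∧ (∀ r < L, s₁.reg r = s.reg r) ∧ s₁.reg L = f a) →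
      Runs _ s₁ _ _ := fun s₁ ⟨e1, e2, e3⟩ =>
    Runs.const_seq (r := L + 1) (x := 0) (Runs.const_seq (r := L + 2) (x := 0)
      (Runs.const_seq (r := L + 3) (x := 1) (Runs.seq (hloop _ (by
      refine ⟨e1, fun r hr => ?_, ?_, ?_, ?_, ?_⟩
      · simp [e2 r hr, show r ≠ L + 1 by omega, show r ≠ L + 2 by omega, show r ≠ L + 3 by omega]
      · simp [e3]
      · simp
      · simp
      · simp)) fun s₅ hs₅ => Runs.copy (r := L) (a := L + 1) (Q := fun s' => s'.mem = s.mem ∧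
          (∀ r < L, s'.reg r = s.reg r) ∧ s'.reg L = ∑ j ∈ Finset.range (f a), g a j)
      ⟨hs₅.1, fun r hr => by simp [hr.ne, hs₅.2.1 r hr], by simp [hs₅.2.2.2.1]⟩)))
  refine ((hp s B h).seq hrun).mono ?_ fun _ h => h
  refine add_le_pow le_rfl ?_
  have hx : (B + 2) ^ ((K + 1 + 2) * K') + (1 + (1 + 1)) + 1 ≤
      (B + 2) ^ ((K + 1 + 2) * K' + 4 + 1) := by
    have := add_le_pow (le_refl ((B + 2) ^ ((K + 1 + 2) * K'))) (le_two_pow_add B 4)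
    omega
  have hy := add_le_pow (mul_le_pow (h1 a B h) hx) (le_two_pow_add B 8)
  omega

end

section

variable {α : Type} [Ctx α]

/-! ### Filling a table -/

/-- The memory after `i` rounds of filling the cells from `b` on, one after the other,
with the values of `f`, which may look up the cells filled before. -/
def fill (a : α) (b : ℕ) (f : α × ℕ → ℕ) : ℕ → ℕ → ℕ
  | 0 => Ctx.mem a
  | i + 1 => Function.update (fill a b f i) (b + i) (f (Ctx.withMem a (fill a b f i), i))

theorem fill_apply (a : α) (b : ℕ) (f : α × ℕ → ℕ) (i j : ℕ) :
    fill a b f i j = if b ≤ j ∧ j < b + i then f (Ctx.withMem a (fill a b f (j - b)), j - b)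
      else Ctx.mem a j := by
  induction i with
  | zero => rw [if_neg (by omega)]; rfl
  | succ i ih =>
    rw [fill, Function.update_apply, ih]
    by_cases h : j = b + i
    · subst h
      rw [if_pos rfl, if_pos (by omega), Nat.add_sub_cancel_left]
    · rw [if_neg h]
      congr 1
      apply propext
      omega

theorem fill_of_lt (a : α) (b : ℕ) (f : α × ℕ → ℕ) (i j : ℕ) (h : j < b) :
    fill a b f i j = Ctx.mem a j := by
  rw [fill_apply, if_neg (by omega)]

theorem fill_cell (a : α) (b : ℕ) (f : α × ℕ → ℕ) {i j : ℕ} (h : j < i) :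
    fill a b f i (b + j) = f (Ctx.withMem a (fill a b f j), j) := by
  rw [fill_apply, if_pos (by omega), Nat.add_sub_cancel_left]

theorem fill_prefix (a : α) (b : ℕ) (f : α × ℕ → ℕ) {i i' j : ℕ} (hi : i ≤ i') (h : j < b + i) :
    fill a b f i j = fill a b f i' j := by
  rw [fill_apply, fill_apply]
  congr 1
  apply propext
  omega

theorem fill_le (a : α) (b : ℕ) (f : α × ℕ → ℕ) (B : ℕ) (hf : ∀ p, f p ≤ B)
    (ha : ∀ j, Ctx.mem a j ≤ B) (i j : ℕ) : fill a b f i j ≤ B := by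
  rw [fill_apply]
  split_ifs
  · exact hf _
  · exact ha j

/-- Cells may depend on earlier cells, and iterating a polynomial bound along the table would blow
up. So `B` is assumed to bound every intermediate memory, and each table has to supply such a bound
itself. -/
theorem Comp.fill {len b : α → ℕ} {f : α × ℕ → ℕ} (hlen : Comp len) (hb : Comp b) (hf : Comp f) :
    ∃ K, ∀ (l : Ctx.Lay α) (L : ℕ), Ctx.Below l L → ∃ p, ∀ s B,
      (∀ i ≤ len (Ctx.dec l s),
        Ctx.Le (Ctx.withMem (Ctx.dec l s) (fill (Ctx.dec l s) (b (Ctx.dec l s)) f i)) B) →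
      Runs p s ((B + 2) ^ K) fun s' => (∀ r < L, s'.reg r = s.reg r) ∧
        s'.mem = UpperEDS.fill (Ctx.dec l s) (b (Ctx.dec l s)) f (len (Ctx.dec l s)) := by
  obtain ⟨K, h1, h2⟩ := hlen
  obtain ⟨Kb, -, h2b⟩ := hb
  obtain ⟨K', -, h2'⟩ := hf
  refine ⟨K + Kb + 1 + (K + ((K + 1 + 2) * K' + 5 + 1) + 8 + 1) + 1, fun l L hl => ?_⟩
  obtain ⟨p, hp⟩ := h2 l L hl
  obtain ⟨pb, hpb⟩ := h2b l (L + 1) (Ctx.below_mono _ _ _ hl (by omega))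
  have hl' : Ctx.Below (α := α × ℕ) (l, L + 2) (L + 4) :=
    ⟨Ctx.below_mono _ _ _ hl (by omega), by simp⟩
  obtain ⟨q, hq⟩ := h2' (l, L + 2) (L + 4) hl'
  refine ⟨.seq (.seq p pb) (.seq (.const (L + 2) 0) (.seq (.const (L + 3) 1)
    (.loop L (.seq q (.seq (.store (L + 1) (L + 4)) (.seq (.add (L + 1) (L + 1) (L + 3))
      (.seq (.add (L + 2) (L + 2) (L + 3)) (.sub L L (L + 3))))))))),
    fun s B h => ?_⟩
  set a := Ctx.dec l s with ha
  have h0 : Ctx.Le a B := by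
    have := h 0 (Nat.zero_le _)
    rwa [UpperEDS.fill, ha, Ctx.mem_dec, Ctx.withMem_mem] at this
  let I : ℕ → State → Prop := fun i s' => s'.mem = UpperEDS.fill a (b a) f i ∧
    (∀ r < L, s'.reg r = s.reg r) ∧
    s'.reg L = len a - i ∧ s'.reg (L + 1) = b a + i ∧ s'.reg (L + 2) = i ∧ s'.reg (L + 3) = 1
  have hloop : ∀ s', I 0 s' → Runs (.loop L (.seq q (.seq (.store (L + 1) (L + 4))
      (.seq (.add (L + 1) (L + 1) (L + 3)) (.seq (.add (L + 2) (L + 2) (L + 3))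
      (.sub L L (L + 3))))))) s'
      (len a * ((B + 2) ^ ((K + 1 + 2) * K') + 4 + 1) + 1) (I (len a)) := by
    intro s' hs'
    refine Runs.loop (fun i s hi hs => hs.2.2.1) (fun i s₁ hi hs₁ => ?_) hs'
    obtain ⟨e1, e2, e3, e4, e5, e6⟩ := hs₁
    -- The variables keep their values during the loop, but the memory seen by `f` is the partly
    -- filled one.
    have hd : Ctx.dec (α := α × ℕ) (l, L + 2) s₁ =
        (Ctx.withMem a (UpperEDS.fill a (b a) f i), i) :=
      Prod.ext (by rw [← e1]; exact Ctx.dec_withMem l L s s₁ hl e2) e5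
    refine Runs.seq (Q := fun s₂ => s₂.mem = s₁.mem ∧ (∀ r < L + 4, s₂.reg r = s₁.reg r) ∧
      s₂.reg (L + 4) = f (Ctx.withMem a (UpperEDS.fill a (b a) f i), i)) ?_
      fun s₂ ⟨d1, d2, d3⟩ => ?_
    · have := hq s₁ ((B + 2) ^ (K + 1)) (by
        rw [hd]
        exact ⟨Ctx.le_mono _ _ _ (h i hi.le) ((le_pow_one B).trans
          (Nat.pow_le_pow_right (by omega) (by omega))),
          pow_mono_right' (hi.le.trans (h1 a B h0)) (by omega)⟩)
      rw [hd] at this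
      exact this.mono (pow_comp_le _ _ _) fun _ h => h
    refine (Runs.store_seq (Runs.add_seq (Runs.add_seq (T := 1) ?_))).mono le_rfl fun _ h => h
    refine Runs.sub ?_
    refine ⟨?_, fun r hr => ?_, ?_, ?_, ?_, ?_⟩
    · simp [d1, d2, e1, e4, d3, UpperEDS.fill]
    · simp [hr.ne, d2 r (by omega), e2 r hr, show r ≠ L + 1 by omega, show r ≠ L + 2 by omega]
    · simp [d2, e3, e6]
      omega
    · simp [d2, e4, e6]
      omega
    · simp [d2, e5, e6]
    · simp [d2, e6]
  have hrun : ∀ s₁, (s₁.mem = s.mem ∧ (∀ r < L, s₁.reg r = s.reg r) ∧ s₁.reg L = len a ∧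
      s₁.reg (L + 1) = b a) → Runs _ s₁ _ _ := fun s₁ ⟨e1, e2, e3, e4⟩ =>
    Runs.const_seq (r := L + 2) (x := 0) (Runs.const_seq (r := L + 3) (x := 1) (hloop _ (by
      refine ⟨?_, fun r hr => ?_, ?_, ?_, ?_, ?_⟩
      · simp [UpperEDS.fill, e1, ha, Ctx.mem_dec]
      · simp [e2 r hr, show r ≠ L + 2 by omega, show r ≠ L + 3 by omega]
      · simp [e3]
      · simp [e4]
      · simp
      · simp)))
  refine ((hp.pair hl hpb s B h0).seq hrun).mono ?_ fun _ h => ⟨h.2.1, h.1⟩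
  refine add_le_pow (pow_add_pow_le _ _ _) ?_
  have hx : (B + 2) ^ ((K + 1 + 2) * K') + 4 + 1 ≤
      (B + 2) ^ ((K + 1 + 2) * K' + 5 + 1) := by
    have := add_le_pow (le_refl ((B + 2) ^ ((K + 1 + 2) * K'))) (le_two_pow_add B 5)
    omega
  have hy := add_le_pow (mul_le_pow (h1 a B h0) hx) (le_two_pow_add B 8)
  omega

/-! ### Derived operations -/

theorem Comp.of_eq {f g : α → ℕ} (hf : Comp f) (h : ∀ a, f a = g a) : Comp g := by
  rwa [← funext h]

theorem Comp.mul {f g : α → ℕ} (hf : Comp f) (hg : Comp g) : Comp (fun a => f a * g a) :=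
  (Comp.sum hf (g := fun a _ => g a) hg.weaken).of_eq fun a => by simp

open Classical in
/-- `P` is decidable, in time polynomial in the numbers in the context. -/
def CompPred (P : α → Prop) : Prop := Comp (fun a => if P a then 1 else 0)

theorem CompPred.comp {P : α → Prop} [DecidablePred P] (hP : CompPred P) :
    Comp (fun a => if P a then 1 else 0) :=
  Comp.of_eq hP fun a => by by_cases h : P a <;> simp [h]

theorem CompPred.of_iff {P Q : α → Prop} (hP : CompPred P) (h : ∀ a, P a ↔ Q a) : CompPred Q := by
  rwa [← funext fun a => propext (h a)]

open Classical in
theorem CompPred.not {P : α → Prop} (hP : CompPred P) : CompPred (fun a => ¬ P a) :=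
  ((Comp.const 1).sub hP).of_eq fun a => by by_cases h : P a <;> simp [h]

open Classical in
theorem CompPred.and {P Q : α → Prop} (hP : CompPred P) (hQ : CompPred Q) :
    CompPred (fun a => P a ∧ Q a) :=
  (Comp.mul hP hQ).of_eq fun a => by by_cases h : P a <;> by_cases h' : Q a <;> simp [h, h']

theorem CompPred.or {P Q : α → Prop} (hP : CompPred P) (hQ : CompPred Q) :
    CompPred (fun a => P a ∨ Q a) :=
  (hP.not.and hQ.not).not.of_iff fun a => by tauto

theorem CompPred.imp {P Q : α → Prop} (hP : CompPred P) (hQ : CompPred Q) :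
    CompPred (fun a => P a → Q a) :=
  (hP.not.or hQ).of_iff fun a => by tauto

theorem CompPred.iff {P Q : α → Prop} (hP : CompPred P) (hQ : CompPred Q) :
    CompPred (fun a => P a ↔ Q a) :=
  ((hP.imp hQ).and (hQ.imp hP)).of_iff fun a => by tauto

open Classical in
theorem CompPred.le {f g : α → ℕ} (hf : Comp f) (hg : Comp g) : CompPred (fun a => f a ≤ g a) :=
  ((Comp.const 1).sub (hf.sub hg)).of_eq fun a => by split_ifs <;> omega

theorem CompPred.lt {f g : α → ℕ} (hf : Comp f) (hg : Comp g) : CompPred (fun a => f a < g a) :=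
  CompPred.le (hf.add (.const 1)) hg

theorem CompPred.eq {f g : α → ℕ} (hf : Comp f) (hg : Comp g) : CompPred (fun a => f a = g a) :=
  ((CompPred.le hf hg).and (CompPred.le hg hf)).of_iff fun a => by omega

open Classical in
-- The number of witnesses is a sum of indicators, and it is tested for being positive.
theorem CompPred.exists_lt {f : α → ℕ} {P : α → ℕ → Prop} (hf : Comp f)
    (hP : CompPred (fun a : α × ℕ => P a.1 a.2)) : CompPred (fun a => ∃ i < f a, P a i) := by
  have h : Comp fun a => ∑ i ∈ Finset.range (f a), if P a i then 1 else 0 := Comp.sum hf hP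
  refine (CompPred.lt (.const 0) h).of_iff fun a => ?_
  rw [Finset.sum_pos_iff]
  constructor
  · rintro ⟨i, hi, h⟩
    exact ⟨i, Finset.mem_range.1 hi, by by_contra h'; simp [h'] at h⟩
  · rintro ⟨i, hi, h⟩
    exact ⟨i, Finset.mem_range.2 hi, by simp [h]⟩

theorem CompPred.forall_lt {f : α → ℕ} {P : α → ℕ → Prop} (hf : Comp f)
    (hP : CompPred (fun a : α × ℕ => P a.1 a.2)) : CompPred (fun a => ∀ i < f a, P a i) :=
  (CompPred.exists_lt (P := fun a i => ¬ P a i) hf hP.not).not.of_iff fun a => by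
    push Not
    rfl

/-- Both branches are evaluated and weighted by indicators; no branch is skipped at run time. -/
theorem Comp.ite {P : α → Prop} [DecidablePred P] {f g : α → ℕ} (hP : CompPred P)
    (hf : Comp f) (hg : Comp g) :
    Comp (fun a => if P a then f a else g a) :=
  ((hP.comp.mul hf).add (hP.not.comp.mul hg)).of_eq fun a => by by_cases h : P a <;> simp [h]

theorem Comp.div {f g : α → ℕ} (hf : Comp f) (hg : Comp g) : Comp (fun a => f a / g a) := by
  -- The quotient is the number of positive multiples of the divisor up to `f a`; the test `0 < g a`
  -- accounts for the convention `x / 0 = 0`.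
  have h : CompPred fun a : α × ℕ => 0 < g a.1 ∧ (a.2 + 1) * g a.1 ≤ f a.1 :=
    (CompPred.lt (.const 0) hg.weaken).and
      (CompPred.le ((Comp.var.add (.const 1)).mul hg.weaken) hf.weaken)
  refine (Comp.sum (g := fun a i => if 0 < g a ∧ (i + 1) * g a ≤ f a then 1 else 0) hf h.comp).of_eq
    fun a => ?_
  rw [← Finset.card_filter]
  rcases Nat.eq_zero_or_pos (g a) with h0 | h0
  · simp [h0]
  rw [← Finset.card_range (f a / g a)]
  congr 1
  ext i
  simp only [Finset.mem_filter, Finset.mem_range, h0, true_and]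
  rw [← Nat.le_div_iff_mul_le h0]
  constructor
  · intro h
    omega
  · intro h
    exact ⟨h.trans_le (Nat.div_le_self _ _), h⟩

theorem Comp.mod {f g : α → ℕ} (hf : Comp f) (hg : Comp g) : Comp (fun a => f a % g a) :=
  (hf.sub (hg.mul (hf.div hg))).of_eq fun a => by
    have := Nat.mod_add_div (f a) (g a)
    omega

end

/-! ### Minimal edge dominating sets as star forests -/

section

variable {V : Type*} {G : SimpleGraph V}

/-- An edge dominating set is minimal iff each of its edges has a private edge. -/
theorem isMinimalEdgeDominating_iff {M : Set (Sym2 V)} : IsMinimalEdgeDominating G M ↔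
    M ⊆ G.edgeSet ∧ (∀ f ∈ G.edgeSet, ∃ g ∈ M, ∃ v, v ∈ f ∧ v ∈ g) ∧
      ∀ e ∈ M, ∃ f ∈ G.edgeSet, ∀ g ∈ M, ∀ v, v ∈ f → v ∈ g → g = e := by
  -- An edge meets itself, so edges of `M'` need not be excluded from the domination condition.
  have hdom : ∀ M', IsEdgeDominating G M' → ∀ f ∈ G.edgeSet, ∃ g ∈ M', ∃ v, v ∈ f ∧ v ∈ g := by
    intro M' h f hf
    by_cases hfM : f ∈ M'
    · induction f with
      | _ a b => exact ⟨_, hfM, a, by simp, by simp⟩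
    · exact h.2 f ⟨hf, hfM⟩
  constructor
  · intro h
    refine ⟨h.prop.1, hdom M h.prop, fun e he => ?_⟩
    -- An edge no longer dominated once `e` is removed is private to `e`; it may be `e` itself.
    have h1 : ¬ IsEdgeDominating G (M \ {e}) := fun h' =>
      (h.le_of_le h' Set.sdiff_subset he).2 rfl
    rw [IsEdgeDominating, not_and] at h1
    have h2 := h1 (Set.sdiff_subset.trans h.prop.1)
    push Not at h2
    obtain ⟨f, hf, h3⟩ := h2
    refine ⟨f, hf.1, fun g hg v hv hv' => ?_⟩
    by_contra hne
    exact h3 g ⟨hg, hne⟩ v hv hv'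
  · rintro ⟨h1, h2, h3⟩
    refine ⟨⟨h1, fun f hf => h2 f hf.1⟩, fun M' hM' hle e he => ?_⟩
    obtain ⟨f, hf, h4⟩ := h3 e he
    obtain ⟨g, hg, v, hv, hv'⟩ := hdom M' hM' f hf
    have hge := h4 g (hle hg) v hv hv'
    rwa [hge] at hg

/-- A set of pairwise disjoint edges whose endpoints cover all edges is a minimal edge
dominating set. -/
theorem isMinimalEdgeDominating_of_disjoint {M : Set (Sym2 V)} (hM : M ⊆ G.edgeSet)
    (hd : ∀ e ∈ M, ∀ f ∈ M, ∀ v, v ∈ e → v ∈ f → f = e)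
    (hc : ∀ u v, G.Adj u v → ∃ e ∈ M, u ∈ e ∨ v ∈ e) : IsMinimalEdgeDominating G M := by
  refine isMinimalEdgeDominating_iff.2 ⟨hM, fun f hf => ?_, fun e he =>
    ⟨e, hM he, fun g hg v hv hv' => hd e he g hg v hv hv'⟩⟩
  induction f with
  | _ a b =>
    obtain ⟨e, he, h | h⟩ := hc a b hf
    · exact ⟨e, he, a, by simp, h⟩
    · exact ⟨e, he, b, by simp, h⟩

/-- A description of a minimal edge dominating set as a star forest. Each vertex has a type:
`0` for uncovered vertices, `1` for leaves with an uncovered neighbour, `2` for endpoints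
of single edges, `3` for centres of stars. Leaves are mapped to their centre, endpoints of single
edges to the other endpoint, centres to one of their leaves. -/
structure StarForest (G : SimpleGraph V) (T : V → ℕ) (π : V → V) : Prop where
  lt : ∀ v, T v < 4
  indep : ∀ u v, T u = 0 → T v = 0 → ¬ G.Adj u v
  leaf : ∀ v, T v = 1 → G.Adj v (π v) ∧ T (π v) = 3 ∧ ∃ u, G.Adj v u ∧ T u = 0
  single : ∀ v, T v = 2 → G.Adj v (π v) ∧ T (π v) = 2 ∧ π (π v) = v
  center : ∀ v, T v = 3 → G.Adj v (π v) ∧ T (π v) = 1 ∧ π (π v) = v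

/-- Twice the contribution of a vertex to the number of edges of a star forest. -/
def gain (t : ℕ) : ℕ := if t = 1 then 2 else if t = 2 then 1 else 0

theorem sum_gain [Fintype V] (T : V → ℕ) : ∑ v, gain (T v) =
    2 * (Finset.univ.filter fun v => T v = 1).card + (Finset.univ.filter fun v => T v = 2).card := by
  rw [Finset.card_filter, Finset.card_filter, Finset.mul_sum, ← Finset.sum_add_distrib]
  refine Finset.sum_congr rfl fun v _ => ?_
  unfold gain
  split_ifs <;> omega

/-- Leaves and endpoints of single edges have degree one in the forest: images of leaves are
centres, and on vertices of types `2` and `3` the map `π` is undone by applying it again. -/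
theorem StarForest.eq_of_mem {T : V → ℕ} {π : V → V} (h : StarForest G T π) {v w : V}
    (hv : T v = 1 ∨ T v = 2) (hw : T w ≠ 0) (hm : v ∈ s(w, π w)) : s(w, π w) = s(v, π v) := by
  rcases Sym2.mem_iff.1 hm with rfl | h1
  · rfl
  have h4 := h.lt w
  have h5 : T w = 1 ∨ T w = 2 ∨ T w = 3 := by omega
  rcases h5 with h5 | h5 | h5
  · have := (h.leaf w h5).2.1
    rw [← h1] at this
    omega
  · have := (h.single w h5).2.2
    rw [← h1] at this
    rw [this, ← h1, Sym2.eq_swap]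
  · have := (h.center w h5).2.2
    rw [← h1] at this
    rw [this, ← h1, Sym2.eq_swap]

theorem StarForest.isYes [Finite V] {T : V → ℕ} {π : V → V} (h : StarForest G T π) {k : ℕ}
    [Fintype V] (hk : 2 * k ≤ ∑ v, gain (T v)) : IsYes G k := by
  classical
  set M : Set (Sym2 V) := {e | ∃ v, T v ≠ 0 ∧ s(v, π v) = e} with hM
  have hcase : ∀ v, T v ≠ 0 → T v = 1 ∨ T v = 2 ∨ T v = 3 := fun v hv => by
    have := h.lt v
    omega
  -- The edge given by a centre is also given by the leaf it points to.
  have hM' : ∀ e ∈ M, ∃ v, (T v = 1 ∨ T v = 2) ∧ s(v, π v) = e := by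
    rintro e ⟨v, hv, rfl⟩
    rcases hcase v hv with h1 | h1 | h1
    · exact ⟨v, by omega, rfl⟩
    · exact ⟨v, by omega, rfl⟩
    · obtain ⟨-, h2, h3⟩ := h.center v h1
      exact ⟨π v, by omega, by rw [h3, Sym2.eq_swap]⟩
  refine ⟨M, isMinimalEdgeDominating_iff.2 ⟨?_, ?_, ?_⟩, ?_⟩
  · rintro e ⟨v, hv, rfl⟩
    rcases hcase v hv with h1 | h1 | h1
    · exact (h.leaf v h1).1
    · exact (h.single v h1).1
    · exact (h.center v h1).1
  · intro f hf
    induction f with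
    | _ a b =>
      by_cases ha : T a = 0
      · by_cases hb : T b = 0
        · exact absurd hf (h.indep a b ha hb)
        · exact ⟨_, ⟨b, hb, rfl⟩, b, by simp, by simp⟩
      · exact ⟨_, ⟨a, ha, rfl⟩, a, by simp, by simp⟩
  · intro e he
    obtain ⟨v, hv, rfl⟩ := hM' e he
    rcases hv with hv | hv
    · obtain ⟨-, -, u, hu, hu'⟩ := h.leaf v hv
      -- The private edge of a leaf leads to its uncovered neighbour; that of a single edge is the
      -- edge itself.
      refine ⟨s(v, u), hu, ?_⟩
      rintro g ⟨w, hw, rfl⟩ x hx hx'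
      rcases Sym2.mem_iff.1 hx with rfl | rfl
      · exact h.eq_of_mem (Or.inl hv) hw hx'
      · exfalso
        rcases Sym2.mem_iff.1 hx' with rfl | rfl
        · exact hw hu'
        · rcases hcase w hw with h1 | h1 | h1
          · have := h.leaf w h1; omega
          · have := h.single w h1; omega
          · have := h.center w h1; omega
    · obtain ⟨h1, h2, h3⟩ := h.single v hv
      refine ⟨s(v, π v), h1, ?_⟩
      rintro g ⟨w, hw, rfl⟩ x hx hx'
      rcases Sym2.mem_iff.1 hx with rfl | rfl
      · exact h.eq_of_mem (Or.inr hv) hw hx'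
      · rw [h.eq_of_mem (Or.inr h2) hw hx', h3, Sym2.eq_swap]
  · rw [sum_gain] at hk
    set A := Finset.univ.filter fun v => T v = 1
    set S := Finset.univ.filter fun v => T v = 2
    have hA : (A.image fun v => s(v, π v)).card = A.card := by
      refine Finset.card_image_of_injOn fun u hu v hv huv => ?_
      have hu : T u = 1 := by simpa [A] using hu
      have hv : T v = 1 := by simpa [A] using hv
      rcases Sym2.eq_iff.1 huv with h1 | h1
      · exact h1.1
      · have := (h.leaf v hv).2.1
        rw [← h1.1] at this
        omega
    -- A single edge arises from at most its two endpoints, while distinct leaves give distinct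
    -- edges.
    have hS : S.card ≤ 2 * (S.image fun v => s(v, π v)).card := by
      refine Finset.card_le_mul_card_image _ _ fun e he => ?_
      induction e with
      | _ a b =>
        refine (Finset.card_le_card (t := {a, b}) fun x hx => ?_).trans Finset.card_le_two
        have hx := (Finset.mem_filter.1 hx).2
        have : x ∈ s(a, b) := by rw [← hx]; simp
        simpa using this
    have hdisj : Disjoint (A.image fun v => s(v, π v)) (S.image fun v => s(v, π v)) := by
      rw [Finset.disjoint_left]
      intro e h1 h2
      obtain ⟨u, hu, rfl⟩ := Finset.mem_image.1 h1
      obtain ⟨v, hv, huv⟩ := Finset.mem_image.1 h2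
      have hu : T u = 1 := by simpa [A] using hu
      have hv : T v = 2 := by simpa [S] using hv
      rcases Sym2.eq_iff.1 huv with h1 | h1
      · rw [h1.1] at hv
        omega
      · have := (h.leaf u hu).2.1
        rw [← h1.1] at this
        omega
    have hsub : ((A.image fun v => s(v, π v)) ∪ (S.image fun v => s(v, π v)) : Finset _).card
        ≤ M.ncard := by
      rw [← Set.ncard_coe_finset]
      refine Set.ncard_le_ncard (fun e he => ?_) (Set.toFinite M)
      simp only [Finset.coe_union, Finset.coe_image, Set.mem_union, Set.mem_image,
        Finset.mem_coe] at he
      rcases he with ⟨v, hv, rfl⟩ | ⟨v, hv, rfl⟩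
      · have hv : T v = 1 := by simpa [A] using hv
        exact ⟨v, by omega, rfl⟩
      · have hv : T v = 2 := by simpa [S] using hv
        exact ⟨v, by omega, rfl⟩
    rw [Finset.card_union_of_disjoint hdisj] at hsub
    omega

theorem exists_starForest [Finite V] [Fintype V] {k : ℕ} (hyes : IsYes G k) :
    ∃ T π, StarForest G T π ∧ 2 * k ≤ ∑ v, gain (T v) := by
  classical
  obtain ⟨M, hM, hk⟩ := hyes
  obtain ⟨hE, hdom, hpriv⟩ := isMinimalEdgeDominating_iff.1 hM
  let Cov : V → Prop := fun v => ∃ a, s(v, a) ∈ M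
  let Big : V → Prop := fun v => ∃ a b, a ≠ b ∧ s(v, a) ∈ M ∧ s(v, b) ∈ M
  have hCov : ∀ v e, e ∈ M → v ∈ e → Cov v := by
    rintro v e he hv
    obtain ⟨y, rfl⟩ := Sym2.mem_iff_exists.1 hv
    exact ⟨y, he⟩
  -- The private edge of `uv` avoids `u`, since a second member at `u` would meet it. So it contains
  -- `v`, and any other member at either of its ends would contradict privacy.
  have key : ∀ u v, s(u, v) ∈ M → Big u → ¬ Big v ∧ ∃ x, G.Adj v x ∧ ¬ Cov x := by
    rintro u v huv ⟨a, b, hab, ha, hb⟩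
    obtain ⟨f, hf, hf'⟩ := hpriv _ huv
    have huf : u ∉ f := fun hu => hab (by
      have h1 := hf' _ ha u hu (by simp)
      have h2 := hf' _ hb u hu (by simp)
      exact Sym2.congr_right.1 (h1.trans h2.symm))
    obtain ⟨g, hg, w, hw, hw'⟩ := hdom f hf
    have hge := hf' g hg w hw hw'
    subst hge
    rcases Sym2.mem_iff.1 hw' with rfl | rfl
    · exact absurd hw huf
    obtain ⟨x, rfl⟩ := Sym2.mem_iff_exists.1 hw
    refine ⟨?_, x, hf, ?_⟩
    · rintro ⟨c, d, hcd, hc, hd⟩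
      have h1 := hf' _ hc w hw (by simp)
      have h2 := hf' _ hd w hw (by simp)
      exact hcd (Sym2.congr_right.1 (h1.trans h2.symm))
    · rintro ⟨y, hy⟩
      have h1 := hf' _ hy x (by simp) (by simp)
      have h2 : x ∈ s(u, w) := by rw [← h1]; simp
      rcases Sym2.mem_iff.1 h2 with rfl | rfl
      · exact huf (by simp)
      · exact G.irrefl hf
  have huniq : ∀ v a b, ¬ Big v → s(v, a) ∈ M → s(v, b) ∈ M → a = b := fun v a b hv ha hb => by
    by_contra hab
    exact hv ⟨a, b, hab, ha, hb⟩
  let T : V → ℕ := fun v => if ¬ Cov v then 0 else if Big v then 3 else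
    if ∃ w, s(v, w) ∈ M ∧ Big w then 1 else 2
  let π : V → V := fun v => if h : Cov v then h.choose else v
  have hπ : ∀ v, Cov v → s(v, π v) ∈ M := fun v hv => by
    simp only [π, dif_pos hv]
    exact hv.choose_spec
  have hπadj : ∀ v, Cov v → G.Adj v (π v) := fun v hv => hE (hπ v hv)
  have hT0 : ∀ v, T v = 0 ↔ ¬ Cov v := fun v => by simp only [T]; split_ifs <;> simp_all
  have hT3 : ∀ v, T v = 3 ↔ Cov v ∧ Big v := fun v => by simp only [T]; split_ifs <;> simp_all
  have hT1 : ∀ v, T v = 1 ↔ Cov v ∧ ¬ Big v ∧ ∃ w, s(v, w) ∈ M ∧ Big w := fun v => by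
    simp only [T]; split_ifs <;> simp_all
  have hT2 : ∀ v, T v = 2 ↔ Cov v ∧ ¬ Big v ∧ ¬ ∃ w, s(v, w) ∈ M ∧ Big w := fun v => by
    simp only [T]; split_ifs <;> simp_all
  have hswap : ∀ u v, s(u, v) ∈ M → s(v, u) ∈ M := fun u v h => Sym2.eq_swap (a := u) ▸ h
  have hS : StarForest G T π := by
    refine ⟨fun v => ?_, fun u v hu hv huv => ?_, fun v hv => ?_, fun v hv => ?_, fun v hv => ?_⟩
    · simp only [T]; split_ifs <;> omega
    · obtain ⟨g, hg, w, hw, hw'⟩ := hdom s(u, v) huv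
      have := hCov w g hg hw'
      rcases Sym2.mem_iff.1 hw with rfl | rfl
      · exact (hT0 w).1 hu this
      · exact (hT0 w).1 hv this
    · obtain ⟨h1, h2, w, h3, h4⟩ := (hT1 v).1 hv
      obtain rfl := huniq v _ _ h2 h3 (hπ v h1)
      refine ⟨hπadj v h1, (hT3 _).2 ⟨⟨v, hswap _ _ h3⟩, h4⟩, ?_⟩
      obtain ⟨x, hx, hx'⟩ := (key _ _ (hswap _ _ h3) h4).2
      exact ⟨x, hx, (hT0 x).2 hx'⟩
    · obtain ⟨h1, h2, h3⟩ := (hT2 v).1 hv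
      have h4 := hπ v h1
      have h5 : Cov (π v) := ⟨v, hswap _ _ h4⟩
      have h6 : ¬ Big (π v) := fun h => h3 ⟨_, h4, h⟩
      refine ⟨hπadj v h1, (hT2 _).2 ⟨h5, h6, ?_⟩, huniq _ _ _ h6 (hπ _ h5) (hswap _ _ h4)⟩
      rintro ⟨w, hw, hw'⟩
      obtain rfl := huniq _ _ _ h6 hw (hswap _ _ h4)
      exact h2 hw'
    · obtain ⟨h1, h2⟩ := (hT3 v).1 hv
      have h4 := hπ v h1
      have h5 : Cov (π v) := ⟨v, hswap _ _ h4⟩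
      have h6 := (key _ _ h4 h2).1
      exact ⟨hπadj v h1, (hT1 _).2 ⟨h5, h6, v, hswap _ _ h4, h2⟩,
        huniq _ _ _ h6 (hπ _ h5) (hswap _ _ h4)⟩
  refine ⟨T, π, hS, ?_⟩
  rw [sum_gain]
  set A := Finset.univ.filter fun v => T v = 1
  set S := Finset.univ.filter fun v => T v = 2
  -- By `key` every edge of `M` has an end that is not big. Such an end has type `1` or `2`, and
  -- this edge is the only one at it.
  have hsub : M ⊆ ((A.image fun v => s(v, π v)) ∪ (S.image fun v => s(v, π v)) : Finset _) := by
    have hone : ∀ u v, s(u, v) ∈ M → ¬ Big u → s(u, v) ∈ ((A.image fun v => s(v, π v)) ∪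
        (S.image fun v => s(v, π v)) : Finset _) := by
      intro u v huv hu
      have h1 : Cov u := ⟨v, huv⟩
      have h2 : T u = 1 ∨ T u = 2 := by
        by_cases h : ∃ w, s(u, w) ∈ M ∧ Big w
        · exact Or.inl ((hT1 u).2 ⟨h1, hu, h⟩)
        · exact Or.inr ((hT2 u).2 ⟨h1, hu, h⟩)
      obtain rfl := huniq u _ _ hu huv (hπ u h1)
      rw [Finset.mem_union, Finset.mem_image, Finset.mem_image]
      rcases h2 with h2 | h2
      · exact Or.inl ⟨u, by simp [A, h2], rfl⟩
      · exact Or.inr ⟨u, by simp [S, h2], rfl⟩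
    intro e he
    induction e with
    | _ u v =>
      by_cases hu : Big u
      · rw [Sym2.eq_swap]
        exact hone v u (hswap _ _ he) (key _ _ he hu).1
      · exact hone u v he hu
  have hcard := Set.ncard_le_ncard hsub (Finset.finite_toSet _)
  rw [Set.ncard_coe_finset] at hcard
  have h1 := Finset.card_union_le (A.image fun v => s(v, π v)) (S.image fun v => s(v, π v))
  have h2 := Finset.card_image_le (s := A) (f := fun v => s(v, π v))
  have h3 : 2 * (S.image fun v => s(v, π v)).card ≤ S.card := by
    refine Finset.mul_card_image_le_card _ _ fun e he => ?_
    obtain ⟨v, hv, rfl⟩ := Finset.mem_image.1 he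
    have hv : T v = 2 := by simpa [S] using hv
    obtain ⟨e1, e2, e3⟩ := hS.single v hv
    rw [← Finset.card_pair e1.ne]
    refine Finset.card_le_card fun x hx => ?_
    rcases Finset.mem_insert.1 hx with rfl | hx
    · simp [S, hv]
    · obtain rfl := Finset.mem_singleton.1 hx
      simp [S, e2, e3]
  omega

end

/-! ### Maximal matchings -/

section

variable {V : Type*} {G : SimpleGraph V}

theorem ncard_endpoints_le [Finite V] (M : Set (Sym2 V)) :
    {v | ∃ e ∈ M, v ∈ e}.ncard ≤ 2 * M.ncard := by
  classical
  have := Fintype.ofFinite V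
  have h : {v | ∃ e ∈ M, v ∈ e} = (M.toFinite.toFinset.biUnion fun e => e.toFinset : Finset V) := by
    ext v
    simp
  rw [h, Set.ncard_coe_finset, Set.ncard_eq_toFinset_card M M.toFinite, mul_comm]
  refine Finset.card_biUnion_le_card_mul _ _ _ fun e _ => ?_
  rw [Sym2.card_toFinset]
  split_ifs <;> omega

theorem isVertexCover_of_maximal {M : G.Subgraph}
    (hM : Maximal (fun M' : G.Subgraph => M'.IsMatching) M) : G.IsVertexCover M.verts := by
  intro u v huv
  by_contra! h
  have hs : (G.subgraphOfAdj huv).support = {u, v} := by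
    rw [(SimpleGraph.Subgraph.IsMatching.subgraphOfAdj huv).support_eq_verts]
    rfl
  -- An edge with both ends unmatched could be added to the matching.
  have h1 : (M ⊔ G.subgraphOfAdj huv).IsMatching := by
    refine hM.prop.sup (.subgraphOfAdj huv) ?_
    rw [hM.prop.support_eq_verts, hs, Set.disjoint_right]
    rintro x (rfl | rfl)
    · exact h.1
    · exact h.2
  have h2 := hM.le_of_ge h1 le_sup_left
  exact h.1 ((le_sup_right.trans h2).1 (by simp))

theorem verts_eq_endpoints {M : G.Subgraph} (hM : M.IsMatching) :
    M.verts = {v | ∃ e ∈ M.edgeSet, v ∈ e} := by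
  ext v
  constructor
  · intro hv
    obtain ⟨w, hw, -⟩ := hM hv
    exact ⟨s(v, w), hw, by simp⟩
  · rintro ⟨e, he, hv⟩
    obtain ⟨w, rfl⟩ := Sym2.mem_iff_exists.1 hv
    exact M.edge_vert he

theorem isMinimalEdgeDominating_of_maximal {M : G.Subgraph}
    (hM : Maximal (fun M' : G.Subgraph => M'.IsMatching) M) :
    IsMinimalEdgeDominating G M.edgeSet := by
  have hv := verts_eq_endpoints hM.prop
  refine isMinimalEdgeDominating_of_disjoint M.edgeSet_subset ?_ fun u v huv => ?_
  · intro e he f hf v hve hvf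
    obtain ⟨a, rfl⟩ := Sym2.mem_iff_exists.1 hve
    obtain ⟨b, rfl⟩ := Sym2.mem_iff_exists.1 hvf
    rw [hM.prop.eq_of_adj_left (SimpleGraph.Subgraph.mem_edgeSet.1 he)
      (SimpleGraph.Subgraph.mem_edgeSet.1 hf)]
  · rcases isVertexCover_of_maximal hM huv with h | h
    · rw [hv] at h
      obtain ⟨e, he, h⟩ := h
      exact ⟨e, he, Or.inl h⟩
    · rw [hv] at h
      obtain ⟨e, he, h⟩ := h
      exact ⟨e, he, Or.inr h⟩

end

/-- A vertex cover `C` yields a tree decomposition with bags `C` and `C ∪ {v}`. -/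
theorem exists_treeDecomposition {n : ℕ} {G : SimpleGraph (Fin n)} {C : Set (Fin n)}
    (hC : G.IsVertexCover C) :
    ∃ D : TreeDecomposition G (Fin (n + 1)), D.WidthLE (C.ncard : ℤ) := by
  -- Any tree will do: a vertex of `C` lies in all bags, any other vertex in exactly one. The extra
  -- node, with bag `C`, keeps the tree nonempty when `n = 0`.
  obtain ⟨T, -, hT⟩ := (SimpleGraph.connected_top (V := Fin (n + 1))).exists_isTree_le
  let bag : Fin (n + 1) → Set (Fin n) := fun t => C ∪ {v | v.castSucc = t}
  refine ⟨⟨T, hT, bag, ?_, ?_, ?_⟩, ?_⟩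
  · exact Set.eq_univ_of_forall fun v => Set.mem_iUnion.2 ⟨v.castSucc, Or.inr rfl⟩
  · intro u v huv
    rcases hC huv with h | h
    · exact ⟨v.castSucc, Set.pair_subset (Or.inl h) (Or.inr rfl)⟩
    · exact ⟨u.castSucc, Set.pair_subset (Or.inr rfl) (Or.inl h)⟩
  · intro t₁ t₂ p hp t ht x hx
    by_cases hxC : x ∈ C
    · exact Or.inl hxC
    obtain rfl : x.castSucc = t₁ := hx.1.resolve_left hxC
    obtain rfl : x.castSucc = t₂ := hx.2.resolve_left hxC
    obtain rfl := (SimpleGraph.Walk.isPath_iff_nil.1 hp).eq_nil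
    obtain rfl : t = x.castSucc := by simpa using ht
    exact Or.inr rfl
  · intro t
    have h1 := Set.ncard_union_le C {v : Fin n | v.castSucc = t}
    have h2 : {v : Fin n | v.castSucc = t}.ncard ≤ 1 := by
      refine (Set.ncard_le_one (Set.toFinite _)).2 fun a ha b hb => ?_
      exact Fin.castSucc_injective n (ha.trans hb.symm)
    change ((C ∪ {v : Fin n | v.castSucc = t}).ncard : ℤ) - 1 ≤ C.ncard
    omega

theorem maximal_matching_dichotomy {n : ℕ} (G : SimpleGraph (Fin n)) (k : ℕ) (M : G.Subgraph)
    (hM : Maximal (fun M' : G.Subgraph => M'.IsMatching) M) :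
    IsMinimalEdgeDominating G M.edgeSet ∧ (k ≤ M.edgeSet.ncard → IsYes G k) ∧
      (M.edgeSet.ncard < k → G.IsVertexCover M.verts ∧ (M.verts.ncard : ℤ) ≤ 2 * (k : ℤ) - 2 ∧
        ∃ (m : ℕ) (D : TreeDecomposition G (Fin m)), D.WidthLE (2 * (k : ℤ) - 1)) := by
  have h1 := isMinimalEdgeDominating_of_maximal hM
  refine ⟨h1, fun h => ⟨_, h1, h⟩, fun h => ?_⟩
  have h2 := isVertexCover_of_maximal hM
  have h3 := ncard_endpoints_le M.edgeSet
  rw [← verts_eq_endpoints hM.prop] at h3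
  obtain ⟨D, hD⟩ := exists_treeDecomposition h2
  refine ⟨h2, by omega, _, D, fun t => (hD t).trans ?_⟩
  omega

/-! ### Scanning the vertices

A star forest is verified by scanning the vertices one after the other, while keeping seven bits of
information on each vertex of a vertex cover `C`: bits `0` to `3` tell its type, bit `4` whether an
uncovered neighbour, bit `5` whether a neighbour of type centre has been seen, and bit `6` whether
it has been matched with its image under `π`. -/

section

variable {n : ℕ} (G : SimpleGraph (Fin n)) (C : Fin n → Prop)

/-- The vertex `v` gets type `t` and is matched with `q`, if `q < n`; this changes the information
from `b` to `b'`. -/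
structure ScanStep (b b' : Fin n → ℕ → Prop) (v : Fin n) (t q : ℕ) : Prop where
  lt : t < 4
  type : C v → ∀ x < 4, (b v x ↔ x = t)
  keep : ∀ c, C c → ∀ x < 4, (b' c x ↔ b c x)
  uncovered : ∀ c, C c → (b' c 4 ↔ b c 4 ∨ (G.Adj v c ∧ t = 0))
  center : ∀ c, C c → (b' c 5 ↔ b c 5 ∨ (G.Adj v c ∧ t = 3))
  mate : ∀ c, C c → (b' c 6 ↔ b c 6 ∨ (q = c ∨ (q < n ∧ c = v)))
  partner : ∀ c : Fin n, q = c → C c ∧ G.Adj v c ∧ ¬ b c 6 ∧ (C v → ¬ b v 6) ∧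
    ((t = 1 ∧ b c 3) ∨ (t = 2 ∧ b c 2) ∨ (t = 3 ∧ b c 1))
  -- When `C` is a vertex cover, all neighbours of a vertex outside `C` lie in `C`, where types are
  -- fixed from the start. So this vertex is checked on the spot, whereas vertices of `C` are
  -- checked by `ScanFinal`.
  leaf : ¬ C v → t = 1 → (∃ c, C c ∧ G.Adj v c ∧ b c 0) ∧ ∃ c, C c ∧ G.Adj v c ∧ b c 3
  mated : ¬ C v → 2 ≤ t → q < n

/-- The information before the scan. -/
def ScanInit (b : Fin n → ℕ → Prop) : Prop := ∀ c, C c → ¬ b c 4 ∧ ¬ b c 5 ∧ ¬ b c 6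

/-- The information after a successful scan. -/
def ScanFinal (b : Fin n → ℕ → Prop) : Prop :=
  ∀ c, C c → (b c 0 → ¬ b c 4) ∧ (b c 1 → b c 4 ∧ b c 5) ∧ (b c 2 → b c 6) ∧ (b c 3 → b c 6)

/-- Bits `4`, `5` and `6` are only ever switched on, so each records whether some event has occurred
so far. -/
theorem accumulate {P : ℕ → Prop} {E : Fin n → Prop} (h0 : ¬ P 0)
    (h : ∀ v : Fin n, P (v + 1) ↔ P v ∨ E v) (j : ℕ) (hj : j ≤ n) :
    P j ↔ ∃ v : Fin n, (v : ℕ) < j ∧ E v := by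
  induction j with
  | zero => simpa using h0
  | succ j ih =>
    rw [h ⟨j, hj⟩, ih (by omega)]
    constructor
    · rintro (⟨v, hv, hE⟩ | hE)
      · exact ⟨v, by omega, hE⟩
      · exact ⟨_, by simp, hE⟩
    · rintro ⟨v, hv, hE⟩
      rcases Nat.lt_succ_iff_lt_or_eq.1 hv with h1 | h1
      · exact Or.inl ⟨v, h1, hE⟩
      · obtain rfl : v = ⟨j, hj⟩ := Fin.ext h1
        exact Or.inr hE

variable {G C}

/-- A successful scan yields a star forest. -/
theorem exists_starForest_of_scan (hC : ∀ u v, G.Adj u v → C u ∨ C v)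
    {b : ℕ → Fin n → ℕ → Prop} {t q : Fin n → ℕ} (h0 : ScanInit C (b 0))
    (hs : ∀ v : Fin n, ScanStep G C (b v) (b (v + 1)) v (t v) (q v)) (hn : ScanFinal C (b n)) :
    ∃ π, StarForest G t π := by
  classical
  have hconst : ∀ c, C c → ∀ x < 4, ∀ j ≤ n, (b j c x ↔ b 0 c x) := by
    intro c hc x hx j
    induction j with
    | zero => exact fun _ => Iff.rfl
    | succ j ih => exact fun hj => ((hs ⟨j, hj⟩).keep c hc x hx).trans (ih (by omega))
  have htype : ∀ c, C c → ∀ x < 4, ∀ j ≤ n, (b j c x ↔ x = t c) := by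
    intro c hc x hx j hj
    rw [hconst c hc x hx j hj, ← hconst c hc x hx c c.2.le]
    exact (hs c).type hc x hx
  have hunc : ∀ c, C c → (b n c 4 ↔ ∃ v : Fin n, (v : ℕ) < n ∧ G.Adj v c ∧ t v = 0) :=
    fun c hc => accumulate (P := fun j => b j c 4) (h0 c hc).1
      (fun v => (hs v).uncovered c hc) n le_rfl
  have hcen : ∀ c, C c → (b n c 5 ↔ ∃ v : Fin n, (v : ℕ) < n ∧ G.Adj v c ∧ t v = 3) :=
    fun c hc => accumulate (P := fun j => b j c 5) (h0 c hc).2.1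
      (fun v => (hs v).center c hc) n le_rfl
  have hmate : ∀ c, C c → ∀ j ≤ n, (b j c 6 ↔
      ∃ v : Fin n, (v : ℕ) < j ∧ (q v = c ∨ (q v < n ∧ c = v))) :=
    fun c hc => accumulate (P := fun j => b j c 6) (h0 c hc).2.2 (fun v => (hs v).mate c hc)
  have hpart : ∀ v c : Fin n, q v = c → C c ∧ G.Adj v c ∧
      ((t v = 1 ∧ t c = 3) ∨ (t v = 2 ∧ t c = 2) ∨ (t v = 3 ∧ t c = 1)) := by
    intro v c hvc
    obtain ⟨h1, h2, -, -, h3⟩ := (hs v).partner c hvc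
    refine ⟨h1, h2, ?_⟩
    rw [htype c h1 3 (by omega) v v.2.le, htype c h1 2 (by omega) v v.2.le,
      htype c h1 1 (by omega) v v.2.le] at h3
    omega
  -- A vertex of `C` is matched at most once, since the later of two events would find its bit `6`
  -- already set.
  have hevent : ∀ c, C c → ∀ v w : Fin n, (q v = c ∨ (q v < n ∧ c = v)) →
      (q w = c ∨ (q w < n ∧ c = w)) → ¬ v < w := by
    intro c hc v w hv hw hlt
    have h1 : b w c 6 := (hmate c hc w w.2.le).2 ⟨v, hlt, hv⟩
    rcases hw with hw | ⟨hw, rfl⟩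
    · exact ((hs w).partner c hw).2.2.1 h1
    · exact ((hs c).partner ⟨q c, hw⟩ rfl).2.2.2.1 hc h1
  have hevent' : ∀ c, C c → ∀ v w : Fin n, (q v = c ∨ (q v < n ∧ c = v)) →
      (q w = c ∨ (q w < n ∧ c = w)) → v = w := fun c hc v w hv hw =>
    le_antisymm (not_lt.1 (hevent c hc w v hw hv)) (not_lt.1 (hevent c hc v w hv hw))
  let R : Fin n → Fin n → Prop := fun x y => q x = y ∨ q y = x
  have hRsymm : ∀ x y, R x y → R y x := fun x y h => h.symm
  have hRuniq : ∀ x y z, R x y → R x z → y = z := by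
    rintro x y z (hy | hy) (hz | hz)
    · exact Fin.ext (hy.symm.trans hz)
    · have h1 := hevent' x (hpart _ _ hz).1 x z (Or.inr ⟨hy ▸ y.2, rfl⟩) (Or.inl hz)
      exact absurd (h1 ▸ (hpart _ _ hz).2.1) (G.irrefl)
    · have h1 := hevent' x (hpart _ _ hy).1 x y (Or.inr ⟨hz ▸ z.2, rfl⟩) (Or.inl hy)
      exact absurd (h1 ▸ (hpart _ _ hy).2.1) (G.irrefl)
    · exact hevent' x (hpart _ _ hy).1 y z (Or.inl hy) (Or.inl hz)
  have hRtype : ∀ x y, R x y → G.Adj x y ∧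
      ((t x = 1 ∧ t y = 3) ∨ (t x = 2 ∧ t y = 2) ∨ (t x = 3 ∧ t y = 1)) := by
    rintro x y (h | h)
    · exact (hpart _ _ h).2
    · obtain ⟨-, h1, h2⟩ := hpart _ _ h
      exact ⟨h1.symm, by omega⟩
  have hRex : ∀ x, 2 ≤ t x → ∃ y, R x y := by
    intro x hx
    by_cases hc : C x
    · have h1 : b n x 6 := by
        have h2 := hn x hc
        have h3 := (hs x).lt
        rw [htype x hc 2 (by omega) n le_rfl, htype x hc 3 (by omega) n le_rfl] at h2
        obtain h4 | h4 : 2 = t x ∨ 3 = t x := by omega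
        · exact h2.2.2.1 h4
        · exact h2.2.2.2 h4
      obtain ⟨v, -, hv | ⟨hv, rfl⟩⟩ := (hmate x hc n le_rfl).1 h1
      · exact ⟨v, Or.inr hv⟩
      · exact ⟨⟨q x, hv⟩, Or.inl rfl⟩
    · exact ⟨⟨q x, (hs x).mated hc hx⟩, Or.inl rfl⟩
  have hleaf : ∀ x, t x = 1 → (∃ c, G.Adj x c ∧ t c = 0) ∧ ∃ c, G.Adj x c ∧ t c = 3 := by
    intro x hx
    by_cases hc : C x
    · obtain ⟨h1, h2⟩ := (hn x hc).2.1 ((htype x hc 1 (by omega) n le_rfl).2 hx.symm)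
      obtain ⟨u, -, hu, hu'⟩ := (hunc x hc).1 h1
      obtain ⟨w, -, hw, hw'⟩ := (hcen x hc).1 h2
      exact ⟨⟨u, hu.symm, hu'⟩, w, hw.symm, hw'⟩
    · obtain ⟨⟨u, hu, hu', hu''⟩, w, hw, hw', hw''⟩ := (hs x).leaf hc hx
      exact ⟨⟨u, hu', ((htype u hu 0 (by omega) x x.2.le).1 hu'').symm⟩,
        w, hw', ((htype w hw 3 (by omega) x x.2.le).1 hw'').symm⟩
  -- Only one leaf of each star needs to be matched with the centre; an unmatched leaf may be
  -- attached to any neighbouring centre. The last default serves uncovered vertices.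
  let π : Fin n → Fin n := fun x => if h : ∃ y, R x y then h.choose else
    if h : ∃ c, G.Adj x c ∧ t c = 3 then h.choose else x
  have hπ : ∀ x y, R x y → π x = y := by
    intro x y h
    have h' : ∃ y, R x y := ⟨y, h⟩
    simp only [π, dif_pos h']
    exact hRuniq x _ _ h'.choose_spec h
  refine ⟨π, fun v => (hs v).lt, ?_, fun v hv => ?_, fun v hv => ?_, fun v hv => ?_⟩
  · have hone : ∀ u v, C v → t u = 0 → t v = 0 → ¬ G.Adj u v := fun u v hc hu hv huv =>
      (hn v hc).1 ((htype v hc 0 (by omega) n le_rfl).2 hv.symm) ((hunc v hc).2 ⟨u, u.2, huv, hu⟩)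
    intro u v hu hv huv
    rcases hC u v huv with h | h
    · exact hone v u h hv hu huv.symm
    · exact hone u v h hu hv huv
  · obtain ⟨h1, h2⟩ := hleaf v hv
    by_cases h : ∃ y, R v y
    · obtain ⟨y, hy⟩ := h
      have := hRtype v y hy
      rw [hπ v y hy]
      exact ⟨this.1, by omega, h1⟩
    · have : π v = h2.choose := by simp only [π, dif_neg h, dif_pos h2]
      rw [this]
      exact ⟨h2.choose_spec.1, h2.choose_spec.2, h1⟩
  · obtain ⟨y, hy⟩ := hRex v (by omega)
    have := hRtype v y hy
    rw [hπ v y hy, hπ y v (hRsymm _ _ hy)]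
    exact ⟨this.1, by omega, rfl⟩
  · obtain ⟨y, hy⟩ := hRex v (by omega)
    have := hRtype v y hy
    rw [hπ v y hy, hπ y v (hRsymm _ _ hy)]
    exact ⟨this.1, by omega, rfl⟩

/-- A star forest can be scanned successfully. -/
theorem exists_scan_of_starForest (hC : ∀ u v, G.Adj u v → C u ∨ C v) {T : Fin n → ℕ}
    {π : Fin n → Fin n} (h : StarForest G T π) :
    ∃ (b : ℕ → Fin n → ℕ → Prop) (q : Fin n → ℕ), ScanInit C (b 0) ∧ (∀ v, q v ≤ n) ∧
      (∀ v : Fin n, ScanStep G C (b v) (b (v + 1)) v (T v) (q v)) ∧ ScanFinal C (b n) := by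
  classical
  -- Pairs exchanged by `π`: the single edges, and each centre with the one leaf it points to.
  let Mt : Fin n → Prop := fun v => T v ≠ 0 ∧ π (π v) = v
  have hMt : ∀ v, 2 ≤ T v → Mt v := by
    intro v hv
    have := h.lt v
    obtain h1 | h1 : T v = 2 ∨ T v = 3 := by omega
    · exact ⟨by omega, (h.single v h1).2.2⟩
    · exact ⟨by omega, (h.center v h1).2.2⟩
  have hπ : ∀ v, T v ≠ 0 → G.Adj v (π v) ∧
      ((T v = 1 ∧ T (π v) = 3) ∨ (T v = 2 ∧ T (π v) = 2) ∨ (T v = 3 ∧ T (π v) = 1)) := by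
    intro v hv
    have := h.lt v
    obtain h1 | h1 | h1 : T v = 1 ∨ T v = 2 ∨ T v = 3 := by omega
    · have := h.leaf v h1
      exact ⟨this.1, by omega⟩
    · have := h.single v h1
      exact ⟨this.1, by omega⟩
    · have := h.center v h1
      exact ⟨this.1, by omega⟩
  -- Each pair is recorded once: by its end outside `C` if there is one, and otherwise by the end
  -- scanned later. A vertex that records nothing gets the dummy partner `n`.
  let D : Fin n → Prop := fun v => Mt v ∧ C (π v) ∧ (C v → π v < v)
  let q : Fin n → ℕ := fun v => if D v then (π v : ℕ) else n
  have hqD : ∀ v, q v < n → D v := fun v hv => by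
    by_contra hD
    simp [q, hD] at hv
  have hq : ∀ v c : Fin n, q v = c ↔ D v ∧ π v = c := by
    intro v c
    by_cases hD : D v
    · simp [q, hD, Fin.ext_iff]
    · simp [q, hD, c.2.ne']
  let b : ℕ → Fin n → ℕ → Prop := fun j c x => (x < 4 ∧ x = T c) ∨
    (x = 4 ∧ ∃ v : Fin n, (v : ℕ) < j ∧ G.Adj v c ∧ T v = 0) ∨
    (x = 5 ∧ ∃ v : Fin n, (v : ℕ) < j ∧ G.Adj v c ∧ T v = 3) ∨
    (x = 6 ∧ ∃ v : Fin n, (v : ℕ) < j ∧ (q v = c ∨ (q v < n ∧ c = v)))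
  have hbt : ∀ j c x, x < 4 → (b j c x ↔ x = T c) := fun j c x hx => by
    simp [b, hx, hx.ne, show x ≠ 5 by omega, show x ≠ 6 by omega]
  have hb4 : ∀ j c, b j c 4 ↔ ∃ v : Fin n, (v : ℕ) < j ∧ G.Adj v c ∧ T v = 0 := fun j c => by
    simp [b]
  have hb5 : ∀ j c, b j c 5 ↔ ∃ v : Fin n, (v : ℕ) < j ∧ G.Adj v c ∧ T v = 3 := fun j c => by
    simp [b]
  have hb6 : ∀ j c, b j c 6 ↔ ∃ v : Fin n, (v : ℕ) < j ∧ (q v = c ∨ (q v < n ∧ c = v)) :=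
    fun j c => by simp [b]
  have hsucc : ∀ (v : Fin n) (E : Fin n → Prop), (∃ w : Fin n, (w : ℕ) < v + 1 ∧ E w) ↔
      (∃ w : Fin n, (w : ℕ) < v ∧ E w) ∨ E v := by
    intro v E
    constructor
    · rintro ⟨w, hw, hE⟩
      rcases Nat.lt_succ_iff_lt_or_eq.1 hw with h1 | h1
      · exact Or.inl ⟨w, h1, hE⟩
      · exact Or.inr (Fin.ext h1 ▸ hE)
    · rintro (⟨w, hw, hE⟩ | hE)
      · exact ⟨w, by omega, hE⟩
      · exact ⟨v, by omega, hE⟩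
  refine ⟨b, q, fun c hc => ?_, fun v => ?_, fun v => ?_, fun c hc => ?_⟩
  · rw [hb4, hb5, hb6]
    simp
  · by_cases hD : D v
    · simp [q, hD, (π v).2.le]
    · simp [q, hD]
  · refine ⟨h.lt v, fun hc x hx => hbt _ _ _ hx, fun c hc x hx => by rw [hbt _ _ _ hx, hbt _ _ _ hx],
      fun c hc => ?_, fun c hc => ?_, fun c hc => ?_, fun c hvc => ?_, fun hv ht => ?_,
      fun hv ht => ?_⟩
    · rw [hb4, hb4, hsucc]
    · rw [hb5, hb5, hsucc]
    · rw [hb6, hb6, hsucc]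
    · obtain ⟨⟨⟨hv0, hvv⟩, hcC, hlt⟩, rfl⟩ := (hq v c).1 hvc
      obtain ⟨hadj, htypes⟩ := hπ v hv0
      refine ⟨hcC, hadj, ?_, fun hv => ?_, ?_⟩
      · rw [hb6]
        rintro ⟨w, hw, h1 | ⟨h1, rfl⟩⟩
        · obtain ⟨⟨⟨-, hww⟩, -⟩, h2⟩ := (hq w _).1 h1
          rw [h2, hvv] at hww
          exact hw.ne (congrArg Fin.val hww.symm)
        · have h2 := (hqD _ h1).2.2 hcC
          rw [hvv] at h2
          exact absurd h2 (not_lt.2 (le_of_lt hw))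
      · rw [hb6]
        rintro ⟨w, hw, h1 | ⟨h1, rfl⟩⟩
        · obtain ⟨⟨⟨-, hww⟩, -, h3⟩, rfl⟩ := (hq w _).1 h1
          rw [hww] at hcC
          exact absurd (h3 hcC) (not_lt.2 (le_of_lt hw))
        · exact absurd hw (lt_irrefl _)
      · rw [hbt _ _ _ (by omega), hbt _ _ _ (by omega), hbt _ _ _ (by omega)]
        omega
    · obtain ⟨h1, h2, u, h3, h4⟩ := h.leaf v ht
      exact ⟨⟨u, (hC v u h3).resolve_left hv, h3, (hbt _ _ _ (by omega)).2 h4.symm⟩,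
        π v, (hC _ _ h1).resolve_left hv, h1, (hbt _ _ _ (by omega)).2 h2.symm⟩
    · have h1 := hMt v ht
      have hD : D v := ⟨h1, (hC _ _ (hπ v h1.1).1).resolve_left hv, fun h => absurd h hv⟩
      rw [(hq v (π v)).2 ⟨hD, rfl⟩]
      exact (π v).2
  · rw [hb4, hb5, hb6, hbt _ _ _ (by omega), hbt _ _ _ (by omega), hbt _ _ _ (by omega),
      hbt _ _ _ (by omega)]
    have hmated : 2 ≤ T c → ∃ v : Fin n, (v : ℕ) < n ∧ (q v = c ∨ (q v < n ∧ c = v)) := by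
      intro h2
      have h1 := hMt c h2
      have h3 := hπ c h1.1
      by_cases hlt : C (π c) → c < π c
      · have hD : D (π c) := ⟨⟨by omega, by rw [h1.2]⟩, by rwa [h1.2], by rwa [h1.2]⟩
        exact ⟨π c, (π c).2, Or.inl ((hq _ _).2 ⟨hD, h1.2⟩)⟩
      · push Not at hlt
        have hD : D c := ⟨h1, hlt.1, fun _ => lt_of_le_of_ne hlt.2 h3.1.ne'⟩
        refine ⟨c, c.2, Or.inr ⟨?_, rfl⟩⟩
        rw [(hq c (π c)).2 ⟨hD, rfl⟩]
        exact (π c).2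
    refine ⟨fun h0 => ?_, fun h1 => ?_, fun h2 => hmated (by omega), fun h2 => hmated (by omega)⟩
    · rintro ⟨v, -, hv, hv'⟩
      exact h.indep v c hv' h0.symm hv
    · obtain ⟨e1, e2, u, e3, e4⟩ := h.leaf c h1.symm
      exact ⟨⟨u, u.2, e3.symm, e4⟩, π c, (π c).2, e1.symm, e2⟩

end

/-! ### Encoding the information kept during a scan -/

open Classical in
/-- The number of elements of `C` below `c`. -/
noncomputable def rank (C : ℕ → Prop) (c : ℕ) : ℕ := ∑ i ∈ Finset.range c, if C i then 1 else 0

theorem rank_mono (C : ℕ → Prop) {c c' : ℕ} (h : c ≤ c') : rank C c ≤ rank C c' :=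
  Finset.sum_le_sum_of_subset (Finset.range_mono h)

theorem rank_succ {C : ℕ → Prop} {c : ℕ} (hc : C c) : rank C (c + 1) = rank C c + 1 := by
  rw [rank, rank, Finset.sum_range_succ, if_pos hc]

theorem rank_lt {C : ℕ → Prop} {c c' : ℕ} (hc : C c) (h : c < c') : rank C c < rank C c' := by
  have := rank_mono C (show c + 1 ≤ c' from h)
  rw [rank_succ hc] at this
  omega

theorem rank_inj {C : ℕ → Prop} {c c' : ℕ} (hc : C c) (hc' : C c') (h : rank C c = rank C c') :
    c = c' := by
  rcases lt_trichotomy c c' with h' | h' | h'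
  · have := rank_lt hc h'
    omega
  · exact h'
  · have := rank_lt hc' h'
    omega

theorem rank_congr {C C' : ℕ → Prop} {n : ℕ} (h : ∀ c < n, (C c ↔ C' c)) {c : ℕ} (hc : c ≤ n) :
    rank C c = rank C' c := by
  classical
  refine Finset.sum_congr rfl fun i hi => ?_
  have := h i (by have := Finset.mem_range.1 hi; omega)
  by_cases h1 : C i
  · rw [if_pos h1, if_pos (this.1 h1)]
  · rw [if_neg h1, if_neg (fun h2 => h1 (this.2 h2))]

theorem rank_eq_ncard {n : ℕ} (C : ℕ → Prop) : rank C n = {v : Fin n | C v}.ncard := by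
  classical
  rw [rank, ← Fin.sum_univ_eq_sum_range (fun i => if C i then 1 else 0) n, ← Finset.card_filter,
    ← Set.ncard_coe_finset]
  congr 1
  ext v
  simp

/-- The information encoded by `S`. -/
def bits (C : ℕ → Prop) (S c x : ℕ) : Prop := C c ∧ Nat.testBit S (7 * rank C c + x)

theorem exists_testBit (P : ℕ → Prop) (E : ℕ) :
    ∃ S < 2 ^ E, ∀ j < E, (Nat.testBit S j = true ↔ P j) := by
  classical
  refine ⟨Nat.ofBits fun j : Fin E => decide (P j), Nat.ofBits_lt_two_pow _, fun j hj => ?_⟩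
  rw [Nat.testBit_ofBits_lt _ _ hj]
  simp

/-- Every information can be encoded, along with a number. -/
theorem exists_bits {n : ℕ} (C : ℕ → Prop) (b : Fin n → ℕ → Prop) (a : ℕ) :
    ∃ S, S / 2 ^ (7 * rank C n) = a ∧
      ∀ c : Fin n, C c → ∀ x < 7, (bits C S c x ↔ b c x) := by
  obtain ⟨S, hS, h⟩ := exists_testBit
    (fun j => ∃ c : Fin n, C c ∧ ∃ x < 7, j = 7 * rank C c + x ∧ b c x) (7 * rank C n)
  refine ⟨2 ^ (7 * rank C n) * a + S, ?_, fun c hc x hx => ?_⟩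
  · rw [Nat.mul_add_div (by positivity), Nat.div_eq_of_lt hS, Nat.add_zero]
  have hr := rank_lt hc c.2
  have hj : 7 * rank C c + x < 7 * rank C n := by omega
  rw [bits, Nat.testBit_two_pow_mul_add _ hS, if_pos hj, h _ hj]
  constructor
  · rintro ⟨-, c', hc', x', hx', h1, h2⟩
    obtain rfl : c = c' := Fin.ext (rank_inj hc hc' (by omega))
    obtain rfl : x = x' := by omega
    exact h2
  · exact fun hb => ⟨hc, c, hc, x, hx, rfl, hb⟩

section

variable {n : ℕ} {G : SimpleGraph (Fin n)} {C : Fin n → Prop}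

theorem ScanInit.congr {b b₁ : Fin n → ℕ → Prop} (h : ∀ c, C c → ∀ x < 7, (b₁ c x ↔ b c x))
    (hb : ScanInit C b) : ScanInit C b₁ := fun c hc => by
  rw [h c hc 4 (by omega), h c hc 5 (by omega), h c hc 6 (by omega)]
  exact hb c hc

theorem ScanFinal.congr {b b₁ : Fin n → ℕ → Prop} (h : ∀ c, C c → ∀ x < 7, (b₁ c x ↔ b c x))
    (hb : ScanFinal C b) : ScanFinal C b₁ := fun c hc => by
  rw [h c hc 0 (by omega), h c hc 1 (by omega), h c hc 2 (by omega), h c hc 3 (by omega),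
    h c hc 4 (by omega), h c hc 5 (by omega), h c hc 6 (by omega)]
  exact hb c hc

theorem ScanStep.congr {b b' b₁ b₁' : Fin n → ℕ → Prop} {v : Fin n} {t q : ℕ}
    (h : ∀ c, C c → ∀ x < 7, (b₁ c x ↔ b c x)) (h' : ∀ c, C c → ∀ x < 7, (b₁' c x ↔ b' c x))
    (hb : ScanStep G C b b' v t q) : ScanStep G C b₁ b₁' v t q where
  lt := hb.lt
  type hv x hx := by rw [h v hv x (by omega), hb.type hv x hx]
  keep c hc x hx := by rw [h c hc x (by omega), h' c hc x (by omega), hb.keep c hc x hx]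
  uncovered c hc := by rw [h c hc _ (by omega), h' c hc _ (by omega), hb.uncovered c hc]
  center c hc := by rw [h c hc _ (by omega), h' c hc _ (by omega), hb.center c hc]
  mate c hc := by rw [h c hc _ (by omega), h' c hc _ (by omega), hb.mate c hc]
  partner c hqc := by
    obtain ⟨h1, h2, h3, h4, h5⟩ := hb.partner c hqc
    rw [h c h1 6 (by omega), h c h1 1 (by omega), h c h1 2 (by omega), h c h1 3 (by omega)]
    exact ⟨h1, h2, h3, fun hv => by rw [h v hv 6 (by omega)]; exact h4 hv, h5⟩
  leaf hv ht := by
    obtain ⟨⟨u, e1, e2, e3⟩, w, e4, e5, e6⟩ := hb.leaf hv ht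
    exact ⟨⟨u, e1, e2, (h u e1 0 (by omega)).2 e3⟩, w, e4, e5, (h w e4 3 (by omega)).2 e6⟩
  mated := hb.mated

end

/-- One step of the scan on the level of codes. -/
def CodeStep {n : ℕ} (G : SimpleGraph (Fin n)) (C : ℕ → Prop) (v : Fin n) (S S' : ℕ) : Prop :=
  ∃ t q, q ≤ n ∧ S' / 2 ^ (7 * rank C n) = S / 2 ^ (7 * rank C n) + gain t ∧
    ScanStep G (fun c => C c) (fun c => bits C S c) (fun c => bits C S' c) v t q

/-- The dynamic program over the codes decides the problem. -/
theorem exists_table_iff_isYes {n : ℕ} {G : SimpleGraph (Fin n)} {C : ℕ → Prop} {k : ℕ}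
    (hC : ∀ u v : Fin n, G.Adj u v → C u ∨ C v) {Q : ℕ}
    (hQ : Q = (2 * n + 1) * 2 ^ (7 * rank C n)) {Tab : ℕ → ℕ → Prop}
    (h0 : ∀ S < Q, (Tab 0 S ↔ S / 2 ^ (7 * rank C n) = 0 ∧
      ScanInit (fun c : Fin n => C c) (fun c => bits C S c)))
    (hs : ∀ v : Fin n, ∀ S' < Q, (Tab (v + 1) S' ↔ ∃ S < Q, Tab v S ∧ CodeStep G C v S S')) :
    (∃ S < Q, Tab n S ∧ 2 * k ≤ S / 2 ^ (7 * rank C n) ∧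
      ScanFinal (fun c : Fin n => C c) (fun c => bits C S c)) ↔ IsYes G k := by
  set N := 2 ^ (7 * rank C n) with hN
  have hNpos : 0 < N := by positivity
  constructor
  · rintro ⟨S, hS, hTab, hk, hfin⟩
    -- Tracing the table back from an accepted code yields the sequence of codes of a scan.
    have hseq : ∀ j ≤ n, ∀ S < Q, Tab j S → ∃ σ : ℕ → ℕ, σ j = S ∧ σ 0 / N = 0 ∧
        ScanInit (fun c : Fin n => C c) (fun c => bits C (σ 0) c) ∧
        ∀ v : Fin n, (v : ℕ) < j → CodeStep G C v (σ v) (σ (v + 1)) := by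
      intro j
      induction j with
      | zero =>
        intro _ S hS hT
        obtain ⟨h1, h2⟩ := (h0 S hS).1 hT
        exact ⟨fun _ => S, rfl, h1, h2, fun v hv => absurd hv (by omega)⟩
      | succ j ih =>
        intro hj S' hS' hT
        obtain ⟨S, hS, hT', hstep⟩ := (hs ⟨j, hj⟩ S' hS').1 hT
        obtain ⟨σ, e1, e2, e3, e4⟩ := ih (by omega) S hS hT'
        refine ⟨Function.update σ (j + 1) S', by simp, by simpa using e2, by simpa using e3,
          fun v hv => ?_⟩
        rcases Nat.lt_succ_iff_lt_or_eq.1 hv with h1 | h1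
        · rw [Function.update_of_ne (by omega), Function.update_of_ne (by omega)]
          exact e4 v h1
        · obtain rfl : v = ⟨j, hj⟩ := Fin.ext h1
          simp only [Function.update_self]
          rw [Function.update_of_ne (by omega), e1]
          exact hstep
    obtain ⟨σ, e1, e2, e3, e4⟩ := hseq n le_rfl S hS hTab
    choose t q hq hcnt hstep using fun v : Fin n => e4 v v.2
    obtain ⟨π, hπ⟩ := exists_starForest_of_scan (C := fun c : Fin n => C c) hC
      (b := fun j c => bits C (σ j) c) e3 hstep (by rw [e1]; exact hfin)
    refine hπ.isYes (hk.trans ?_)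
    rw [← e1]
    have hsum : ∀ j (hj : j ≤ n), σ j / N = ∑ v : Fin j, gain (t (Fin.castLE hj v)) := by
      intro j
      induction j with
      | zero => intro _; simpa using e2
      | succ j ih =>
        intro hj
        rw [Fin.sum_univ_castSucc, hcnt ⟨j, hj⟩]
        change σ j / N + _ = _
        rw [ih (by omega)]
        rfl
    exact (hsum n le_rfl).le
  · intro hyes
    obtain ⟨T, π, hT, hk⟩ := exists_starForest hyes
    obtain ⟨b, q, e1, e2, e3, e4⟩ :=
      exists_scan_of_starForest (C := fun c : Fin n => C c) hC hT
    let cnt : ℕ → ℕ := fun j => ∑ v ∈ Finset.univ.filter fun v : Fin n => (v : ℕ) < j, gain (T v)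
    choose σ hσ hbits using fun j => exists_bits C (b j) (cnt j)
    -- Each vertex gains at most `2`, so the counter never exceeds `2 * n`; this is the factor `2 *
    -- n + 1` in `Q`.
    have hlt : ∀ j, σ j < Q := by
      intro j
      rw [hQ, ← Nat.div_lt_iff_lt_mul hNpos, hσ j]
      have : cnt j ≤ n * 2 := by
        refine (Finset.sum_le_card_nsmul _ _ 2 fun v _ => ?_).trans ?_
        · unfold gain
          split_ifs <;> omega
        · rw [smul_eq_mul]
          refine Nat.mul_le_mul_right _ ((Finset.card_le_univ _).trans ?_)
          simp
      omega
    have hTab : ∀ j ≤ n, Tab j (σ j) := by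
      intro j
      induction j with
      | zero =>
        intro _
        exact (h0 _ (hlt 0)).2 ⟨by rw [hσ]; simp [cnt], e1.congr (hbits 0)⟩
      | succ j ih =>
        intro hj
        refine (hs ⟨j, hj⟩ _ (hlt _)).2 ⟨σ j, hlt j, ih (by omega), T ⟨j, hj⟩, q ⟨j, hj⟩,
          e2 _, ?_, (e3 ⟨j, hj⟩).congr (hbits j) (hbits (j + 1))⟩
        rw [hσ, hσ]
        have : (Finset.univ.filter fun v : Fin n => (v : ℕ) < j + 1) =
            insert ⟨j, hj⟩ (Finset.univ.filter fun v : Fin n => (v : ℕ) < j) := by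
          ext v
          simp only [Finset.mem_filter, Finset.mem_univ, true_and, Finset.mem_insert, Fin.ext_iff]
          omega
        simp only [cnt]
        rw [this, Finset.sum_insert (by simp), add_comm]
    refine ⟨σ n, hlt n, hTab n le_rfl, ?_, e4.congr (hbits n)⟩
    rw [hσ]
    simpa [cnt] using hk

/-! ### The greedy matching -/

/-- The pairs encoded by `i` and `j` are disjoint. -/
def Separated (n i j : ℕ) : Prop := i / n ≠ j / n ∧ i / n ≠ j % n ∧ i % n ≠ j / n ∧ i % n ≠ j % n

/-- The vertices of the pairs encoded by the elements of `X`. -/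
def endpoints (n : ℕ) (X : ℕ → Prop) (c : ℕ) : Prop := ∃ w < n, X (n * c + w) ∨ X (n * w + c)

/-- `X` is the set of codes of the edges chosen by the greedy algorithm for a maximal matching. -/
def IsGreedy {n : ℕ} (G : SimpleGraph (Fin n)) (X : ℕ → Prop) : Prop :=
  ∀ u v : Fin n, X (n * u + v) ↔ G.Adj u v ∧ ∀ j < n * u + v, X j → Separated n (n * u + v) j

section

variable {n : ℕ}

theorem code_div (u v : Fin n) : (n * (u : ℕ) + v) / n = u := by
  rw [Nat.mul_add_div (by have := v.2; omega), Nat.div_eq_of_lt v.2, Nat.add_zero]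

theorem code_mod (u v : Fin n) : (n * (u : ℕ) + v) % n = v := by
  rw [Nat.mul_add_mod, Nat.mod_eq_of_lt v.2]

theorem code_lt (u v : Fin n) : n * (u : ℕ) + v < n * n := by
  have := Nat.mul_le_mul_left n (show (u : ℕ) + 1 ≤ n from u.2)
  have h := v.2
  rw [Nat.mul_succ] at this
  omega

theorem exists_code {i : ℕ} (hi : i < n * n) : ∃ u v : Fin n, i = n * u + v := by
  have hn : 0 < n := Nat.pos_of_ne_zero (by rintro rfl; simp at hi)
  exact ⟨⟨i / n, Nat.div_lt_of_lt_mul hi⟩, ⟨i % n, Nat.mod_lt _ hn⟩, (Nat.div_add_mod i n).symm⟩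

variable {G : SimpleGraph (Fin n)} {X : ℕ → Prop}

/-- The edges chosen. -/
def greedyEdges (n : ℕ) (X : ℕ → Prop) : Set (Sym2 (Fin n)) :=
  {e | ∃ u v : Fin n, X (n * u + v) ∧ e = s(u, v)}

theorem endpoints_iff (c : Fin n) : endpoints n X c ↔ ∃ e ∈ greedyEdges n X, c ∈ e := by
  constructor
  · rintro ⟨w, hw, h | h⟩
    · exact ⟨_, ⟨c, ⟨w, hw⟩, h, rfl⟩, by simp⟩
    · exact ⟨_, ⟨⟨w, hw⟩, c, h, rfl⟩, by simp⟩
  · rintro ⟨_, ⟨u, v, h, rfl⟩, hc⟩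
    rcases Sym2.mem_iff.1 hc with rfl | rfl
    · exact ⟨v, v.2, Or.inl h⟩
    · exact ⟨u, u.2, Or.inr h⟩

/-- An edge that is not chosen is blocked by an earlier chosen edge sharing a vertex with it. -/
theorem IsGreedy.cover (hX : IsGreedy G X) (u v : Fin n) (huv : G.Adj u v) :
    endpoints n X u ∨ endpoints n X v := by
  by_cases h : X (n * u + v)
  · exact Or.inl ⟨v, v.2, Or.inl h⟩
  rw [hX u v, not_and] at h
  have h1 := h huv
  push Not at h1
  obtain ⟨j, hj, hXj, hsep⟩ := h1
  obtain ⟨a, b, rfl⟩ := exists_code (hj.trans (code_lt u v))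
  have ha : endpoints n X a := ⟨b, b.2, Or.inl hXj⟩
  have hb : endpoints n X b := ⟨a, a.2, Or.inr hXj⟩
  simp only [Separated, code_div, code_mod] at hsep
  by_cases h1 : (u : ℕ) = a
  · exact Or.inl (h1 ▸ ha)
  by_cases h2 : (u : ℕ) = b
  · exact Or.inl (h2 ▸ hb)
  by_cases h3 : (v : ℕ) = a
  · exact Or.inr (h3 ▸ ha)
  by_cases h4 : (v : ℕ) = b
  · exact Or.inr (h4 ▸ hb)
  exact absurd ⟨h1, h2, h3, h4⟩ hsep

theorem IsGreedy.isMinimalEdgeDominating (hX : IsGreedy G X) :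
    IsMinimalEdgeDominating G (greedyEdges n X) := by
  -- Two chosen codes with a common vertex must coincide, as the larger would not be separated from
  -- the smaller. In particular only one of the two codes of an edge is chosen.
  have hsep : ∀ u v a b x : Fin n, X (n * u + v) → X (n * a + b) → x ∈ s(u, v) → x ∈ s(a, b) →
      ¬ n * (a : ℕ) + b < n * u + v := by
    intro u v a b x h1 h2 hx hx' hlt
    have := ((hX u v).1 h1).2 _ hlt h2
    simp only [Separated, code_div, code_mod, ne_eq, Fin.val_inj] at this
    rcases Sym2.mem_iff.1 hx with rfl | rfl <;> rcases Sym2.mem_iff.1 hx' with rfl | rfl <;> tauto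
  refine isMinimalEdgeDominating_of_disjoint ?_ ?_ fun u v huv => ?_
  · rintro _ ⟨u, v, h, rfl⟩
    exact ((hX u v).1 h).1
  · rintro _ ⟨u, v, h, rfl⟩ _ ⟨a, b, h', rfl⟩ x hx hx'
    have h1 := hsep u v a b x h h' hx hx'
    have h2 := hsep a b u v x h' h hx' hx
    have h3 : n * (u : ℕ) + v = n * a + b := by omega
    have h4 := code_div u v
    have h5 := code_mod u v
    rw [h3, code_div] at h4
    rw [h3, code_mod] at h5
    rw [Fin.ext h4, Fin.ext h5]
  · rcases hX.cover u v huv with h | h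
    · obtain ⟨e, he, h⟩ := (endpoints_iff u).1 h
      exact ⟨e, he, Or.inl h⟩
    · obtain ⟨e, he, h⟩ := (endpoints_iff v).1 h
      exact ⟨e, he, Or.inr h⟩

/-- The algorithm counts matched vertices instead of edges; there are at most twice as many of them
as edges. -/
theorem IsGreedy.isYes (hX : IsGreedy G X) {k : ℕ} (hk : 2 * k ≤ rank (endpoints n X) n) :
    IsYes G k := by
  refine ⟨_, hX.isMinimalEdgeDominating, ?_⟩
  have h := ncard_endpoints_le (greedyEdges n X)
  simp only [← endpoints_iff] at h
  rw [rank_eq_ncard] at hk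
  omega

end

/-! ### The tables of the algorithm

The memory holds the adjacency matrix in the first `n * n` cells, the edges chosen by the greedy
algorithm in the next `n * n` cells, then powers of two, and then the table of the dynamic
program. -/

/-- Edge `i` has been chosen. -/
def chosen (m : ℕ → ℕ) (n i : ℕ) : Prop := m (n * n + i) = 1

/-- The vertex `c` is an endpoint of an edge chosen. -/
def covered (m : ℕ → ℕ) (n : ℕ) : ℕ → Prop := endpoints n (chosen m n)

/-- The information encoded by `S`, the powers of two being looked up in the memory. -/
def memBits (m : ℕ → ℕ) (n S c x : ℕ) : Prop :=
  covered m n c ∧ S / m (2 * (n * n) + (7 * rank (covered m n) c + x)) % 2 = 1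

/-- The codes at the start of the scan. -/
def memInit (m : ℕ → ℕ) (n N S : ℕ) : Prop :=
  S / N = 0 ∧ ∀ c < n, covered m n c → ¬ memBits m n S c 4 ∧ ¬ memBits m n S c 5 ∧
    ¬ memBits m n S c 6

/-- The codes at the end of a scan that finds `k` edges. -/
def memFinal (m : ℕ → ℕ) (n k N S : ℕ) : Prop :=
  2 * k ≤ S / N ∧ ∀ c < n, covered m n c → (memBits m n S c 0 → ¬ memBits m n S c 4) ∧
    (memBits m n S c 1 → memBits m n S c 4 ∧ memBits m n S c 5) ∧
    (memBits m n S c 2 → memBits m n S c 6) ∧ (memBits m n S c 3 → memBits m n S c 6)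

/-- What a step of the scan does to the information on the vertex `c`. -/
def memUpdate (m : ℕ → ℕ) (n v S S' t q c : ℕ) : Prop :=
  (∀ x < 4, (memBits m n S' c x ↔ memBits m n S c x)) ∧
  (memBits m n S' c 4 ↔ memBits m n S c 4 ∨ (m (n * v + c) = 1 ∧ t = 0)) ∧
  (memBits m n S' c 5 ↔ memBits m n S c 5 ∨ (m (n * v + c) = 1 ∧ t = 3)) ∧
  (memBits m n S' c 6 ↔ memBits m n S c 6 ∨ (q = c ∨ (q < n ∧ c = v)))

/-- The vertex `v` of type `t` can be matched with `q`. -/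
def memPartner (m : ℕ → ℕ) (n v S t q : ℕ) : Prop :=
  covered m n q ∧ m (n * v + q) = 1 ∧ ¬ memBits m n S q 6 ∧
    (covered m n v → ¬ memBits m n S v 6) ∧
    ((t = 1 ∧ memBits m n S q 3) ∨ (t = 2 ∧ memBits m n S q 2) ∨ (t = 3 ∧ memBits m n S q 1))

/-- The vertex `v` has a neighbour with the bit `x` set. -/
def memNeighbour (m : ℕ → ℕ) (n v S x : ℕ) : Prop :=
  ∃ c < n, covered m n c ∧ m (n * v + c) = 1 ∧ memBits m n S c x

/-- A step of the scan with prescribed type and partner. -/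
def memScan (m : ℕ → ℕ) (n v S S' t q : ℕ) : Prop :=
  (covered m n v → ∀ x < 4, (memBits m n S v x ↔ x = t)) ∧
  (∀ c < n, covered m n c → memUpdate m n v S S' t q c) ∧
  (q < n → memPartner m n v S t q) ∧
  (¬ covered m n v → t = 1 → memNeighbour m n v S 0 ∧ memNeighbour m n v S 3) ∧
  (¬ covered m n v → 2 ≤ t → q < n)

/-- A step of the scan. -/
def memStep (m : ℕ → ℕ) (n N v S R : ℕ) : Prop :=
  ∃ t < 4, ∃ q < n + 1, R / N = S / N + gain t ∧ memScan m n v S R t q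

/-- The greedy algorithm chooses edge `i`. -/
def GreedyCond (m : ℕ → ℕ) (n i : ℕ) : Prop :=
  m i = 1 ∧ ∀ j < i, chosen m n j → Separated n i j

open Classical in
/-- The cells of the table of the greedy algorithm. -/
noncomputable def greedyCell (m : ℕ → ℕ) (n i : ℕ) : ℕ := if GreedyCond m n i then 1 else 0

/-- The cells of the table of powers of two. -/
def powCell (m : ℕ → ℕ) (n i : ℕ) : ℕ := if i = 0 then 1 else 2 * m (2 * (n * n) + (i - 1))

/-- The number of codes. -/
def codes (n N : ℕ) : ℕ := (2 * n + 1) * N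

/-- The recursion of the dynamic program, whose table starts at `b`. -/
def ScanCond (m : ℕ → ℕ) (n N b i : ℕ) : Prop :=
  (i < codes n N ∧ memInit m n N i) ∨ (codes n N ≤ i ∧ ∃ S < codes n N,
    m (b + ((i / codes n N - 1) * codes n N + S)) = 1 ∧
      memStep m n N (i / codes n N - 1) S (i % codes n N))

open Classical in
/-- The cells of the table of the dynamic program. -/
noncomputable def scanCell (m : ℕ → ℕ) (n N b i : ℕ) : ℕ := if ScanCond m n N b i then 1 else 0

/-- The length of the codes in bits, or `0` if the greedy matching has at least `k` edges. -/
noncomputable def codeLength (m : ℕ → ℕ) (n k : ℕ) : ℕ :=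
  if rank (covered m n) n < 2 * k then 7 * rank (covered m n) n else 0

/-- The greedy matching has at least `k` edges, or the dynamic program is successful. -/
def Accepts (m : ℕ → ℕ) (n k N b : ℕ) : Prop :=
  rank (covered m n) n < 2 * k → ∃ S < codes n N, m (b + (n * codes n N + S)) = 1 ∧
    memFinal m n k N S

open Classical in
/-- The output. -/
noncomputable def answer (m : ℕ → ℕ) (n k N b : ℕ) : ℕ := if Accepts m n k N b then 1 else 0

/-! ### Polynomial computability of the table cells. -/

section

variable {α : Type} [Ctx α]

theorem comp_adj {n u v : α → ℕ} (hn : Comp n) (hu : Comp u) (hv : Comp v) :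
    CompPred fun a => Ctx.mem a (n a * u a + v a) = 1 :=
  .eq (.load ((hn.mul hu).add hv)) (.const 1)

theorem comp_chosen {n i : α → ℕ} (hn : Comp n) (hi : Comp i) :
    CompPred fun a => chosen (Ctx.mem a) (n a) (i a) :=
  .eq (.load ((hn.mul hn).add hi)) (.const 1)

theorem comp_covered {n c : α → ℕ} (hn : Comp n) (hc : Comp c) :
    CompPred fun a => covered (Ctx.mem a) (n a) (c a) := by
  unfold covered endpoints
  exact .exists_lt hn (.or (comp_chosen hn.weaken ((hn.weaken.mul hc.weaken).add .var))
    (comp_chosen hn.weaken ((hn.weaken.mul .var).add hc.weaken)))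

theorem comp_rank {n c : α → ℕ} (hn : Comp n) (hc : Comp c) :
    Comp fun a => rank (covered (Ctx.mem a) (n a)) (c a) := by
  unfold rank
  exact .sum hc (comp_covered hn.weaken .var)

/-- Exponentiation is not polynomially bounded and thus not available in `Comp`; a bit is extracted
by dividing by a power read from the memory. -/
theorem comp_memBits {n S c x : α → ℕ} (hn : Comp n) (hS : Comp S) (hc : Comp c) (hx : Comp x) :
    CompPred fun a => memBits (Ctx.mem a) (n a) (S a) (c a) (x a) := by
  unfold memBits
  exact (comp_covered hn hc).and (.eq (.mod (.div hS (.load (((Comp.const 2).mul (hn.mul hn)).add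
    (((Comp.const 7).mul (comp_rank hn hc)).add hx)))) (.const 2)) (.const 1))

theorem comp_memInit {n N S : α → ℕ} (hn : Comp n) (hN : Comp N) (hS : Comp S) :
    CompPred fun a => memInit (Ctx.mem a) (n a) (N a) (S a) := by
  have hb : ∀ x, CompPred fun a : α × ℕ => memBits (Ctx.mem a) (n a.1) (S a.1) a.2 x :=
    fun x => comp_memBits hn.weaken hS.weaken .var (.const x)
  unfold memInit
  exact .and (.eq (hS.div hN) (.const 0)) (.forall_lt hn (.imp (comp_covered hn.weaken .var)
    ((hb 4).not.and ((hb 5).not.and (hb 6).not))))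

theorem comp_memFinal {n k N S : α → ℕ} (hn : Comp n) (hk : Comp k) (hN : Comp N) (hS : Comp S) :
    CompPred fun a => memFinal (Ctx.mem a) (n a) (k a) (N a) (S a) := by
  have hb : ∀ x, CompPred fun a : α × ℕ => memBits (Ctx.mem a) (n a.1) (S a.1) a.2 x :=
    fun x => comp_memBits hn.weaken hS.weaken .var (.const x)
  unfold memFinal
  exact .and (.le ((Comp.const 2).mul hk) (hS.div hN)) (.forall_lt hn (.imp
    (comp_covered hn.weaken .var) (((hb 0).imp (hb 4).not).and (((hb 1).imp ((hb 4).and (hb 5))).and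
    (((hb 2).imp (hb 6)).and ((hb 3).imp (hb 6)))))))

theorem comp_memUpdate {n v S S' t q c : α → ℕ} (hn : Comp n) (hv : Comp v) (hS : Comp S)
    (hS' : Comp S') (ht : Comp t) (hq : Comp q) (hc : Comp c) :
    CompPred fun a => memUpdate (Ctx.mem a) (n a) (v a) (S a) (S' a) (t a) (q a) (c a) := by
  have hb : ∀ x, CompPred fun a : α => memBits (Ctx.mem a) (n a) (S a) (c a) x :=
    fun x => comp_memBits hn hS hc (.const x)
  have hb' : ∀ x, CompPred fun a : α => memBits (Ctx.mem a) (n a) (S' a) (c a) x :=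
    fun x => comp_memBits hn hS' hc (.const x)
  unfold memUpdate
  exact .and (.forall_lt (.const 4) (.iff (comp_memBits hn.weaken hS'.weaken hc.weaken .var)
      (comp_memBits hn.weaken hS.weaken hc.weaken .var)))
    (.and (.iff (hb' 4) ((hb 4).or ((comp_adj hn hv hc).and (.eq ht (.const 0)))))
    (.and (.iff (hb' 5) ((hb 5).or ((comp_adj hn hv hc).and (.eq ht (.const 3)))))
    (.iff (hb' 6) ((hb 6).or (.or (.eq hq hc) (.and (.lt hq hn) (.eq hc hv)))))))

theorem comp_memPartner {n v S t q : α → ℕ} (hn : Comp n) (hv : Comp v) (hS : Comp S)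
    (ht : Comp t) (hq : Comp q) :
    CompPred fun a => memPartner (Ctx.mem a) (n a) (v a) (S a) (t a) (q a) := by
  have hb : ∀ x, CompPred fun a : α => memBits (Ctx.mem a) (n a) (S a) (q a) x :=
    fun x => comp_memBits hn hS hq (.const x)
  unfold memPartner
  exact .and (comp_covered hn hq) (.and (comp_adj hn hv hq) (.and (hb 6).not
    (.and (.imp (comp_covered hn hv) (comp_memBits hn hS hv (.const 6)).not)
    (.or (.and (.eq ht (.const 1)) (hb 3)) (.or (.and (.eq ht (.const 2)) (hb 2))
      (.and (.eq ht (.const 3)) (hb 1)))))))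

theorem comp_memNeighbour {n v S x : α → ℕ} (hn : Comp n) (hv : Comp v) (hS : Comp S)
    (hx : Comp x) : CompPred fun a => memNeighbour (Ctx.mem a) (n a) (v a) (S a) (x a) := by
  unfold memNeighbour
  exact .exists_lt hn (.and (comp_covered hn.weaken .var) (.and
    (comp_adj hn.weaken hv.weaken .var) (comp_memBits hn.weaken hS.weaken .var hx.weaken)))

theorem comp_memScan {n v S S' t q : α → ℕ} (hn : Comp n) (hv : Comp v) (hS : Comp S)
    (hS' : Comp S') (ht : Comp t) (hq : Comp q) :
    CompPred fun a => memScan (Ctx.mem a) (n a) (v a) (S a) (S' a) (t a) (q a) := by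
  unfold memScan
  exact .and (.imp (comp_covered hn hv) (.forall_lt (.const 4) (.iff
      (comp_memBits hn.weaken hS.weaken hv.weaken .var) (.eq .var ht.weaken))))
    (.and (.forall_lt hn (.imp (comp_covered hn.weaken .var) (comp_memUpdate hn.weaken hv.weaken
      hS.weaken hS'.weaken ht.weaken hq.weaken .var)))
    (.and (.imp (.lt hq hn) (comp_memPartner hn hv hS ht hq))
    (.and (.imp (comp_covered hn hv).not (.imp (.eq ht (.const 1)) (.and
      (comp_memNeighbour hn hv hS (.const 0)) (comp_memNeighbour hn hv hS (.const 3)))))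
    (.imp (comp_covered hn hv).not (.imp (.le (.const 2) ht) (.lt hq hn))))))

theorem comp_gain {t : α → ℕ} (ht : Comp t) : Comp fun a => gain (t a) := by
  unfold gain
  exact .ite (.eq ht (.const 1)) (.const 2) (.ite (.eq ht (.const 2)) (.const 1) (.const 0))

theorem comp_memStep {n N v S S' : α → ℕ} (hn : Comp n) (hN : Comp N) (hv : Comp v) (hS : Comp S)
    (hS' : Comp S') : CompPred fun a => memStep (Ctx.mem a) (n a) (N a) (v a) (S a) (S' a) := by
  have hgain : Comp fun a : (α × ℕ) × ℕ => gain a.1.2 := (comp_gain .var).weaken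
  unfold memStep
  exact .exists_lt (.const 4) (.exists_lt (hn.weaken.add (.const 1)) (.and
    (.eq (hS'.weaken.weaken.div hN.weaken.weaken)
      ((hS.weaken.weaken.div hN.weaken.weaken).add hgain))
    (comp_memScan hn.weaken.weaken hv.weaken.weaken hS.weaken.weaken hS'.weaken.weaken
      (Comp.weaken .var) .var)))

theorem comp_greedyCell {n i : α → ℕ} (hn : Comp n) (hi : Comp i) :
    Comp fun a => greedyCell (Ctx.mem a) (n a) (i a) := by
  have h : ∀ {f g : α × ℕ → ℕ}, Comp f → Comp g → CompPred fun a => f a ≠ g a :=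
    fun hf hg => (CompPred.eq hf hg).not
  change CompPred fun a => GreedyCond (Ctx.mem a) (n a) (i a)
  unfold GreedyCond Separated
  exact CompPred.and (.eq (.load hi) (.const 1)) (.forall_lt hi (.imp (comp_chosen hn.weaken .var)
    (.and (h (hi.weaken.div hn.weaken) (Comp.var.div hn.weaken))
    (.and (h (hi.weaken.div hn.weaken) (Comp.var.mod hn.weaken))
    (.and (h (hi.weaken.mod hn.weaken) (Comp.var.div hn.weaken))
    (h (hi.weaken.mod hn.weaken) (Comp.var.mod hn.weaken)))))))

theorem comp_powCell {n i : α → ℕ} (hn : Comp n) (hi : Comp i) :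
    Comp fun a => powCell (Ctx.mem a) (n a) (i a) := by
  unfold powCell
  exact .ite (.eq hi (.const 0)) (.const 1) ((Comp.const 2).mul
    (.load (((Comp.const 2).mul (hn.mul hn)).add (hi.sub (.const 1)))))

theorem comp_codes {n N : α → ℕ} (hn : Comp n) (hN : Comp N) : Comp fun a => codes (n a) (N a) :=
  (((Comp.const 2).mul hn).add (.const 1)).mul hN

theorem comp_scanCell {n N b i : α → ℕ} (hn : Comp n) (hN : Comp N) (hb : Comp b) (hi : Comp i) :
    Comp fun a => scanCell (Ctx.mem a) (n a) (N a) (b a) (i a) := by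
  have hQ := comp_codes hn hN
  have hv := (hi.div hQ).sub (.const 1)
  change CompPred fun a => ScanCond (Ctx.mem a) (n a) (N a) (b a) (i a)
  unfold ScanCond
  exact CompPred.or (.and (.lt hi hQ) (comp_memInit hn hN hi)) (.and (.le hQ hi)
    (.exists_lt hQ (.and (.eq (.load (hb.weaken.add ((hv.weaken.mul hQ.weaken).add .var)))
      (.const 1)) (comp_memStep hn.weaken hN.weaken hv.weaken .var (hi.mod hQ).weaken))))

theorem comp_codeLength {n k : α → ℕ} (hn : Comp n) (hk : Comp k) :
    Comp fun a => codeLength (Ctx.mem a) (n a) (k a) := by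
  unfold codeLength
  exact .ite (.lt (comp_rank hn hn) ((Comp.const 2).mul hk))
    ((Comp.const 7).mul (comp_rank hn hn)) (.const 0)

theorem comp_answer {n k N b : α → ℕ} (hn : Comp n) (hk : Comp k) (hN : Comp N) (hb : Comp b) :
    Comp fun a => answer (Ctx.mem a) (n a) (k a) (N a) (b a) := by
  have hQ := comp_codes hn hN
  change CompPred fun a => Accepts (Ctx.mem a) (n a) (k a) (N a) (b a)
  unfold Accepts
  exact CompPred.imp (.lt (comp_rank hn hn) ((Comp.const 2).mul hk)) (.exists_lt hQ (.and
    (.eq (.load (hb.weaken.add ((hn.weaken.mul hQ.weaken).add .var))) (.const 1))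
    (comp_memFinal hn.weaken hk.weaken hN.weaken .var)))

end

/-! ### Correctness of the tables -/

/-- The memory holds the adjacency matrix of `G`, the set `X` of edges chosen, and powers of two
up to `2 ^ e`. -/
structure GoodMem {n : ℕ} (G : SimpleGraph (Fin n)) (X : ℕ → Prop) (e : ℕ) (m : ℕ → ℕ) :
    Prop where
  adj : ∀ u v : Fin n, m (n * u + v) = 1 ↔ G.Adj u v
  chosen : ∀ i < n * n, (chosen m n i ↔ X i)
  pow : ∀ j ≤ e, m (2 * (n * n) + j) = 2 ^ j

/-- From `n * n` on, `chosen` reads cells beyond its table, so agreement is asked only for codes of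
pairs of vertices. `endpoints` inspects no others when `c < n`. -/
theorem covered_congr {n : ℕ} {m : ℕ → ℕ} {X : ℕ → Prop} (h : ∀ i < n * n, (chosen m n i ↔ X i))
    {c : ℕ} (hc : c < n) : covered m n c ↔ endpoints n X c := by
  have h1 : ∀ w < n, (chosen m n (n * c + w) ↔ X (n * c + w)) := fun w hw =>
    h _ (code_lt ⟨c, hc⟩ ⟨w, hw⟩)
  have h2 : ∀ w < n, (chosen m n (n * w + c) ↔ X (n * w + c)) := fun w hw =>
    h _ (code_lt ⟨w, hw⟩ ⟨c, hc⟩)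
  constructor
  · rintro ⟨w, hw, h⟩
    exact ⟨w, hw, by rwa [← h1 w hw, ← h2 w hw]⟩
  · rintro ⟨w, hw, h⟩
    exact ⟨w, hw, by rwa [h1 w hw, h2 w hw]⟩

namespace GoodMem

variable {n : ℕ} {G : SimpleGraph (Fin n)} {X : ℕ → Prop} {m : ℕ → ℕ}

theorem covered {e : ℕ} (h : GoodMem G X e m) (c : Fin n) :
    UpperEDS.covered m n c ↔ endpoints n X c := covered_congr h.chosen c.2

theorem memBits (h : GoodMem G X (7 * rank (endpoints n X) n) m) (S : ℕ) (c : Fin n) {x : ℕ}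
    (hx : x < 7) : memBits m n S c x ↔ bits (endpoints n X) S c x := by
  rw [UpperEDS.memBits, bits, h.covered c]
  refine and_congr_right fun hc => ?_
  have hr : rank (UpperEDS.covered m n) c = rank (endpoints n X) c :=
    rank_congr (fun c hc => covered_congr h.chosen hc) c.2.le
  -- The block of a vertex of the cover ends within the code length, so the power needed is in the
  -- table.
  have := rank_lt hc c.2
  rw [hr, h.pow _ (by omega), Nat.testBit_eq_decide_div_mod_eq, decide_eq_true_iff]

theorem memInit (h : GoodMem G X (7 * rank (endpoints n X) n) m) (N S : ℕ) :
    memInit m n N S ↔ S / N = 0 ∧ ScanInit (fun c : Fin n => endpoints n X c)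
      (fun c => bits (endpoints n X) S c) := by
  refine and_congr_right fun _ => ?_
  have key : ∀ c : Fin n, (UpperEDS.covered m n c → ¬ UpperEDS.memBits m n S c 4 ∧
      ¬ UpperEDS.memBits m n S c 5 ∧ ¬ UpperEDS.memBits m n S c 6) ↔ (endpoints n X c →
      ¬ bits (endpoints n X) S c 4 ∧ ¬ bits (endpoints n X) S c 5 ∧
      ¬ bits (endpoints n X) S c 6) := fun c => by
    rw [h.covered, h.memBits S c (by omega), h.memBits S c (by omega), h.memBits S c (by omega)]
  exact ⟨fun H c => (key c).1 (H c c.2), fun H c hc => (key ⟨c, hc⟩).2 (H ⟨c, hc⟩)⟩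

theorem memFinal (h : GoodMem G X (7 * rank (endpoints n X) n) m) (k N S : ℕ) :
    memFinal m n k N S ↔ 2 * k ≤ S / N ∧ ScanFinal (fun c : Fin n => endpoints n X c)
      (fun c => bits (endpoints n X) S c) := by
  refine and_congr_right fun _ => ?_
  have hb := fun (c : Fin n) (x : ℕ) (hx : x < 7) => h.memBits S c hx
  constructor
  · intro H c hc
    have := H c c.2 ((h.covered c).2 hc)
    rwa [hb c 0 (by omega), hb c 1 (by omega), hb c 2 (by omega), hb c 3 (by omega),
      hb c 4 (by omega), hb c 5 (by omega), hb c 6 (by omega)] at this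
  · intro H c hc hcc
    lift c to Fin n using hc
    rw [hb c 0 (by omega), hb c 1 (by omega), hb c 2 (by omega), hb c 3 (by omega),
      hb c 4 (by omega), hb c 5 (by omega), hb c 6 (by omega)]
    exact H c ((h.covered c).1 hcc)

theorem memNeighbour (h : GoodMem G X (7 * rank (endpoints n X) n) m) (v : Fin n) (S : ℕ) {x : ℕ}
    (hx : x < 7) : memNeighbour m n v S x ↔
      ∃ c : Fin n, endpoints n X c ∧ G.Adj v c ∧ bits (endpoints n X) S c x := by
  constructor
  · rintro ⟨c, hc, h1, h2, h3⟩
    exact ⟨⟨c, hc⟩, (h.covered ⟨c, hc⟩).1 h1, (h.adj v ⟨c, hc⟩).1 h2,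
      (h.memBits S ⟨c, hc⟩ hx).1 h3⟩
  · rintro ⟨c, h1, h2, h3⟩
    exact ⟨c, c.2, (h.covered c).2 h1, (h.adj v c).2 h2, (h.memBits S c hx).2 h3⟩

theorem memScan (h : GoodMem G X (7 * rank (endpoints n X) n) m) (v : Fin n) (S S' t q : ℕ)
    (ht : t < 4) : memScan m n v S S' t q ↔ ScanStep G (fun c : Fin n => endpoints n X c)
      (fun c => bits (endpoints n X) S c) (fun c => bits (endpoints n X) S' c) v t q := by
  have hb := fun (S : ℕ) (c : Fin n) (x : ℕ) (hx : x < 7) => h.memBits S c hx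
  have hupd : ∀ c : Fin n, memUpdate m n v S S' t q c ↔
      (∀ x < 4, (bits (endpoints n X) S' c x ↔ bits (endpoints n X) S c x)) ∧
      (bits (endpoints n X) S' c 4 ↔ bits (endpoints n X) S c 4 ∨ (G.Adj v c ∧ t = 0)) ∧
      (bits (endpoints n X) S' c 5 ↔ bits (endpoints n X) S c 5 ∨ (G.Adj v c ∧ t = 3)) ∧
      (bits (endpoints n X) S' c 6 ↔ bits (endpoints n X) S c 6 ∨
        (q = c ∨ (q < n ∧ c = v))) := by
    intro c
    rw [memUpdate, hb S c 4 (by omega), hb S c 5 (by omega), hb S c 6 (by omega),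
      hb S' c 4 (by omega), hb S' c 5 (by omega), hb S' c 6 (by omega), h.adj v c, Fin.ext_iff]
    refine and_congr_left fun _ => forall₂_congr fun x hx => ?_
    rw [hb S c x (by omega), hb S' c x (by omega)]
  have hpart : ∀ c : Fin n, memPartner m n v S t c ↔ endpoints n X c ∧ G.Adj v c ∧
      ¬ bits (endpoints n X) S c 6 ∧ (endpoints n X v → ¬ bits (endpoints n X) S v 6) ∧
      ((t = 1 ∧ bits (endpoints n X) S c 3) ∨ (t = 2 ∧ bits (endpoints n X) S c 2) ∨
        (t = 3 ∧ bits (endpoints n X) S c 1)) := by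
    intro c
    rw [memPartner, hb S c 6 (by omega), hb S c 1 (by omega), hb S c 2 (by omega),
      hb S c 3 (by omega), hb S v 6 (by omega), h.adj v c, h.covered, h.covered]
  rw [UpperEDS.memScan, h.memNeighbour v S (by omega), h.memNeighbour v S (by omega), h.covered]
  constructor
  · rintro ⟨h1, h2, h3, h4, h5⟩
    have h2' := fun (c : Fin n) (hc : endpoints n X c) =>
      (hupd c).1 (h2 c c.2 ((h.covered c).2 hc))
    refine ⟨ht, fun hv x hx => ?_, fun c hc => (h2' c hc).1, fun c hc => (h2' c hc).2.1,
      fun c hc => (h2' c hc).2.2.1, fun c hc => (h2' c hc).2.2.2, ?_, h4, h5⟩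
    · rw [← hb S v x (by omega)]
      exact h1 hv x hx
    · rintro c rfl
      exact (hpart c).1 (h3 c.2)
  · intro hs
    refine ⟨fun hv x hx => ?_, fun c hc hcc => ?_, fun hq => ?_, hs.leaf, hs.mated⟩
    · rw [hb S v x (by omega)]
      exact hs.type hv x hx
    · have hcc' := (h.covered ⟨c, hc⟩).1 hcc
      exact (hupd ⟨c, hc⟩).2 ⟨hs.keep _ hcc', hs.uncovered _ hcc', hs.center _ hcc',
        hs.mate _ hcc'⟩
    · exact (hpart ⟨q, hq⟩).2 (hs.partner ⟨q, hq⟩ rfl)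

theorem memStep (h : GoodMem G X (7 * rank (endpoints n X) n) m) (v : Fin n) (S S' : ℕ) :
    memStep m n (2 ^ (7 * rank (endpoints n X) n)) v S S' ↔
      CodeStep G (endpoints n X) v S S' := by
  constructor
  · rintro ⟨t, ht, q, hq, h1, h2⟩
    exact ⟨t, q, by omega, h1, (h.memScan v S S' t q ht).1 h2⟩
  · rintro ⟨t, q, hq, h1, h2⟩
    exact ⟨t, h2.lt, q, by omega, h1, (h.memScan v S S' t q h2.lt).2 h2⟩

end GoodMem

/-! ### The contents of the memory in each phase. -/

/-- The context with variables `n` and `k`. -/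
abbrev Ctx₂ : Type := ((ℕ → ℕ) × ℕ) × ℕ

/-- The context with variables `n`, `k` and the length of the codes. -/
abbrev Ctx₃ : Type := Ctx₂ × ℕ

/-- The context with variables `n`, `k`, the length of the codes, and `2` to this power. -/
abbrev Ctx₄ : Type := Ctx₃ × ℕ

/-- The memory while the first table is filled. -/
noncomputable def greedyMem (a : Ctx₂) : ℕ → ℕ → ℕ :=
  fill a (a.1.2 * a.1.2) fun p => greedyCell (Ctx.mem p) p.1.1.2 p.2

/-- The memory while the second table is filled. -/
noncomputable def powMem (a : Ctx₃) : ℕ → ℕ → ℕ :=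
  fill a (2 * (a.1.1.2 * a.1.1.2)) fun p => powCell (Ctx.mem p) p.1.1.1.2 p.2

/-- The start of the third table. -/
def scanBase (n e : ℕ) : ℕ := 2 * (n * n) + (e + 1)

/-- The memory while the third table is filled. -/
noncomputable def scanMem (a : Ctx₄) : ℕ → ℕ → ℕ :=
  fill a (scanBase a.1.1.1.2 a.1.2) fun p =>
    scanCell (Ctx.mem p) p.1.1.1.1.2 p.1.2 (scanBase p.1.1.1.1.2 p.1.1.2) p.2

theorem input_mem_le {n : ℕ} (G : SimpleGraph (Fin n)) (k i : ℕ) : (input G k).mem i ≤ 1 := by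
  simp only [input]
  split_ifs <;> simp

theorem input_mem_code {n : ℕ} (G : SimpleGraph (Fin n)) (k : ℕ) (u v : Fin n) :
    (input G k).mem (n * u + v) = 1 ↔ G.Adj u v := by
  have h : (∃ u' v' : Fin n, n * (u : ℕ) + v = n * (u' : ℕ) + v' ∧ G.Adj u' v') ↔ G.Adj u v := by
    constructor
    · rintro ⟨u', v', h, hadj⟩
      have h1 := code_div u v
      have h2 := code_mod u v
      rw [h, code_div] at h1
      rw [h, code_mod] at h2
      rwa [← Fin.ext h1, ← Fin.ext h2]
    · exact fun h => ⟨u, v, rfl, h⟩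
  simp only [input]
  rw [← h]
  split_ifs with h' <;> simp [h']

theorem greedyMem_le (a : Ctx₂) {B : ℕ} (hB : 1 ≤ B) (h : ∀ j, a.1.1 j ≤ B) (i j : ℕ) :
    greedyMem a i j ≤ B := by
  refine fill_le _ _ _ _ (fun p => ?_) h i j
  unfold greedyCell
  split_ifs <;> omega

theorem scanMem_le (a : Ctx₄) {B : ℕ} (hB : 1 ≤ B) (h : ∀ j, a.1.1.1.1 j ≤ B) (i j : ℕ) :
    scanMem a i j ≤ B := by
  refine fill_le _ _ _ _ (fun p => ?_) h i j
  unfold scanCell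
  split_ifs <;> omega

theorem greedyCell_eq_one {m : ℕ → ℕ} {n i : ℕ} : greedyCell m n i = 1 ↔ GreedyCond m n i := by
  rw [greedyCell]
  split_ifs with h <;> simp [h]

theorem scanCell_eq_one {m : ℕ → ℕ} {n N b i : ℕ} :
    scanCell m n N b i = 1 ↔ ScanCond m n N b i := by
  rw [scanCell]
  split_ifs with h <;> simp [h]

/-- When cell `i` is computed, the adjacency matrix is untouched and the cells before `i` already
have their final values. -/
theorem isGreedy_greedyMem {n : ℕ} (G : SimpleGraph (Fin n)) (k : ℕ) :
    IsGreedy G (chosen (greedyMem (((input G k).mem, n), k) (n * n)) n) := by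
  intro u v
  set a : Ctx₂ := (((input G k).mem, n), k)
  set i := n * (u : ℕ) + v with hi
  have hlt : i < n * n := code_lt u v
  have h1 : chosen (greedyMem a (n * n)) n i ↔ GreedyCond (greedyMem a i) n i := by
    rw [chosen, ← greedyCell_eq_one]
    exact Eq.congr_left (fill_cell _ _ _ hlt)
  have h2 : greedyMem a i i = (input G k).mem i := fill_of_lt _ _ _ _ _ hlt
  rw [h1, GreedyCond, h2, hi, input_mem_code, ← hi]
  refine and_congr_right fun _ => forall₂_congr fun j hj => ?_
  have h3 : greedyMem a i (n * n + j) = greedyMem a (n * n) (n * n + j) :=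
    fill_prefix _ _ _ hlt.le (Nat.add_lt_add_left hj _)
  rw [chosen, chosen, h3]

theorem powMem_eq (a : Ctx₃) (j : ℕ) : ∀ i, j < i →
    powMem a i (2 * (a.1.1.2 * a.1.1.2) + j) = 2 ^ j := by
  induction j with
  | zero =>
    intro i hi
    rw [powMem, fill_cell _ _ _ hi, powCell, if_pos rfl, pow_zero]
  | succ j ih =>
    intro i hi
    rw [powMem, fill_cell _ _ _ hi, powCell, if_neg (by simp), pow_succ', ← ih (j + 1) (by omega)]
    rfl

/-- Unlike the other two tables, this one is not made of zeros and ones; its entries stay below `B`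
only because it stops at exponent `e`. -/
theorem powMem_le (a : Ctx₃) {B e : ℕ} (hB : 2 ^ e ≤ B) (h : ∀ j, a.1.1.1 j ≤ B) (i j : ℕ)
    (hi : i ≤ e + 1) : powMem a i j ≤ B := by
  by_cases hj : 2 * (a.1.1.2 * a.1.1.2) ≤ j ∧ j < 2 * (a.1.1.2 * a.1.1.2) + i
  · obtain ⟨l, rfl⟩ := Nat.exists_eq_add_of_le hj.1
    rw [powMem_eq a l i (by omega)]
    exact (Nat.pow_le_pow_right (by omega) (by omega)).trans hB
  · rw [powMem, fill_apply, if_neg hj]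
    exact h j

theorem accepts_iff {n : ℕ} (G : SimpleGraph (Fin n)) (k : ℕ) {m₁ m₂ : ℕ → ℕ} {e : ℕ}
    (hm₁ : m₁ = greedyMem (((input G k).mem, n), k) (n * n)) (he : e = codeLength m₁ n k)
    (hm₂ : m₂ = powMem (((m₁, n), k), e) (e + 1)) :
    Accepts (scanMem ((((m₂, n), k), e), 2 ^ e) ((n + 1) * codes n (2 ^ e))) n k (2 ^ e)
      (scanBase n e) ↔ IsYes G k := by
  set Q := codes n (2 ^ e) with hQ
  set a : Ctx₄ := ((((m₂, n), k), e), 2 ^ e) with ha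
  set X := chosen m₁ n with hX
  have hgreedy : IsGreedy G X := by
    rw [hX, hm₁]
    exact isGreedy_greedyMem G k
  have hlow₂ : ∀ j < 2 * (n * n), m₂ j = m₁ j := fun j hj => by
    rw [hm₂]
    exact fill_of_lt _ _ _ _ _ hj
  have hlow : ∀ i, ∀ j < scanBase n e, scanMem a i j = m₂ j := fun i j hj =>
    fill_of_lt _ _ _ _ _ hj
  have hgood : ∀ i, GoodMem G X e (scanMem a i) := by
    intro i
    refine ⟨fun u v => ?_, fun j hj => ?_, fun j hj => ?_⟩
    · have := code_lt u v
      rw [hlow i _ (by unfold scanBase; omega), hlow₂ _ (by omega), ← input_mem_code G k u v, hm₁]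
      rw [show greedyMem (((input G k).mem, n), k) (n * n) (n * u + v) = _ from
        fill_of_lt _ _ _ _ _ this]
      rfl
    · rw [chosen, hlow i _ (by unfold scanBase; omega), hlow₂ _ (by omega), hX, chosen]
    · rw [hlow i _ (by unfold scanBase; omega), hm₂]
      exact powMem_eq (((m₁, n), k), e) j (e + 1) (by omega)
  have hrank : rank (covered (scanMem a ((n + 1) * Q)) n) n = rank (endpoints n X) n :=
    rank_congr (fun c hc => covered_congr (hgood _).chosen hc) le_rfl
  have hrank₁ : rank (covered m₁ n) n = rank (endpoints n X) n := rfl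
  rw [Accepts, hrank]
  -- If the matching is large, both sides hold without the dynamic program.
  by_cases hk : rank (endpoints n X) n < 2 * k
  swap
  · exact iff_of_true (fun h => absurd h hk) (hgreedy.isYes (not_lt.1 hk))
  obtain rfl : e = 7 * rank (endpoints n X) n := by rw [he, codeLength, hrank₁, if_pos hk]
  have hQpos : 0 < Q := by rw [hQ, codes]; positivity
  -- The table is stored row by row: the cell of code `S` after `v` vertices has index `v * Q + S`.
  have hcell : ∀ v S, v ≤ n → S < Q → (scanMem a ((n + 1) * Q)
      (scanBase n (7 * rank (endpoints n X) n) + (v * Q + S)) = 1 ↔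
      ScanCond (scanMem a (v * Q + S)) n (2 ^ (7 * rank (endpoints n X) n))
        (scanBase n (7 * rank (endpoints n X) n)) (v * Q + S)) := by
    intro v S hv hS
    have hlt : v * Q + S < (n + 1) * Q := by
      have := Nat.mul_le_mul_right Q hv
      rw [Nat.succ_mul]
      omega
    rw [← scanCell_eq_one]
    exact Eq.congr_left (fill_cell _ _ _ hlt)
  rw [← exists_table_iff_isYes hgreedy.cover (Q := Q) (C := endpoints n X) (k := k) hQ
    (Tab := fun v S => scanMem a ((n + 1) * Q)
      (scanBase n (7 * rank (endpoints n X) n) + (v * Q + S)) = 1)]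
  · rw [imp_iff_right hk]
    refine exists_congr fun S => and_congr_right fun hS => and_congr_right fun _ => ?_
    exact (hgood _).memFinal k _ S
  · intro S hS
    rw [hcell 0 S (by omega) hS, ScanCond, ← hQ, Nat.zero_mul, Nat.zero_add,
      (hgood S).memInit]
    simp [hS]
  · intro v S' hS'
    rw [hcell (v + 1) S' v.2 hS', ScanCond, ← hQ]
    have h1 : ((v + 1) * Q + S') / Q = v + 1 := by
      rw [mul_comm, Nat.mul_add_div hQpos, Nat.div_eq_of_lt hS', Nat.add_zero]
    have h2 : ((v + 1) * Q + S') % Q = S' := by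
      rw [mul_comm, Nat.mul_add_mod, Nat.mod_eq_of_lt hS']
    have h3 : Q ≤ (v + 1) * Q + S' := by
      rw [Nat.succ_mul]
      omega
    rw [h1, h2, Nat.add_sub_cancel, or_iff_right (fun h => absurd h.1 (by omega)), and_iff_right h3]
    refine exists_congr fun S => and_congr_right fun hS => ?_
    rw [(hgood _).memStep]
    -- Row `v` is complete by the time a cell of row `v + 1` is computed.
    have h4 : scanMem a ((v + 1) * Q + S')
        (scanBase n (7 * rank (endpoints n X) n) + (v * Q + S)) = scanMem a ((n + 1) * Q)
        (scanBase n (7 * rank (endpoints n X) n) + (v * Q + S)) := by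
      have := Nat.mul_le_mul_right Q (show (v : ℕ) + 1 ≤ n from v.2)
      refine fill_prefix _ _ _ ?_ (Nat.add_lt_add_left ?_ _)
      · rw [Nat.succ_mul n]
        omega
      · rw [Nat.succ_mul]
        omega
    rw [h4]

/-! ### The program -/

/-- A bound for all numbers that occur in the course of the algorithm. -/
def valueBound (n k : ℕ) : ℕ := (n + 1) * 2 ^ (14 * k)

theorem pow_le_valueBound (n : ℕ) {k e : ℕ} (he : e ≤ 14 * k) : 2 ^ e ≤ valueBound n k :=
  (Nat.pow_le_pow_right (by omega) he).trans (Nat.le_mul_of_pos_left _ (by omega))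

/-- The value `0` in the case of a large matching matters here: the remaining tables are filled in
any case and must stay small even if the cover is large. -/
theorem codeLength_le (m : ℕ → ℕ) (n k : ℕ) : codeLength m n k ≤ 14 * k := by
  unfold codeLength
  split_ifs <;> omega

/-- A single program computes the output in time polynomial in the bound for the values. -/
theorem exists_program : ∃ (p : Prog) (K : ℕ), ∀ (n : ℕ) (G : SimpleGraph (Fin n)) (k : ℕ),
    Runs p (input G k) ((valueBound n k + 2) ^ K) fun s =>
      (IsYes G k → s.reg 0 = 1) ∧ (¬ IsYes G k → s.reg 0 = 0) := by
  have hn₂ : Comp fun a : Ctx₂ => a.1.2 := Comp.weaken .var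
  have hn₃ : Comp fun a : Ctx₃ => a.1.1.2 := hn₂.weaken
  have hn₄ : Comp fun a : Ctx₄ => a.1.1.1.2 := hn₃.weaken
  have hk₂ : Comp fun a : Ctx₂ => a.2 := .var
  have he₃ : Comp fun a : Ctx₃ => a.2 := .var
  have hN₄ : Comp fun a : Ctx₄ => a.2 := .var
  have hbase : Comp fun a : Ctx₄ => scanBase a.1.1.1.2 a.1.2 :=
    ((Comp.const 2).mul (hn₄.mul hn₄)).add (he₃.weaken.add (.const 1))
  obtain ⟨K_greedy, h_greedy⟩ := Comp.fill (hn₂.mul hn₂) (hn₂.mul hn₂)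
    (comp_greedyCell (α := Ctx₂ × ℕ) hn₂.weaken .var)
  obtain ⟨K_len, -, h_len⟩ := comp_codeLength hn₂ hk₂
  obtain ⟨K_pow, h_pow⟩ := Comp.fill (he₃.add (.const 1)) ((Comp.const 2).mul (hn₃.mul hn₃))
    (comp_powCell (α := Ctx₃ × ℕ) hn₃.weaken .var)
  -- The variable `2 ^ e` is obtained by reading the last cell of the table of powers.
  obtain ⟨K_load, -, h_load⟩ := Comp.load (((Comp.const 2).mul (hn₃.mul hn₃)).add he₃)
  obtain ⟨K_scan, h_scan⟩ := Comp.fill ((hn₄.add (.const 1)).mul (comp_codes hn₄ hN₄)) hbase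
    (comp_scanCell (α := Ctx₄ × ℕ) hn₄.weaken hN₄.weaken hbase.weaken .var)
  obtain ⟨K_ans, -, h_ans⟩ := comp_answer hn₄ hk₂.weaken.weaken hN₄ hbase
  let l₂ : Ctx.Lay Ctx₂ := (((), 0), 1)
  let l₃ : Ctx.Lay Ctx₃ := (l₂, 2)
  let l₄ : Ctx.Lay Ctx₄ := (l₃, 3)
  have hl₂ : Ctx.Below l₂ 2 := ⟨⟨trivial, by decide⟩, by decide⟩
  have hl₃ : Ctx.Below l₃ 3 := ⟨⟨⟨trivial, by decide⟩, by decide⟩, by decide⟩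
  have hl₄ : Ctx.Below l₄ 4 := ⟨⟨⟨⟨trivial, by decide⟩, by decide⟩, by decide⟩, by decide⟩
  obtain ⟨p_greedy, h_greedy⟩ := h_greedy l₂ 2 hl₂
  obtain ⟨p_len, h_len⟩ := h_len l₂ 2 hl₂
  obtain ⟨p_pow, h_pow⟩ := h_pow l₃ 3 hl₃
  obtain ⟨p_load, h_load⟩ := h_load l₃ 3 hl₃
  obtain ⟨p_scan, h_scan⟩ := h_scan l₄ 4 hl₄
  obtain ⟨p_ans, h_ans⟩ := h_ans l₄ 4 hl₄
  -- Registers `0` to `3` hold `n`, `k`, the code length and its power of two; the output arrives in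
  -- register `4` and is copied to register `0`.
  refine ⟨.seq p_greedy (.seq p_len (.seq p_pow (.seq p_load (.seq p_scan
    (.seq p_ans (.copy 0 4)))))),
    K_greedy + (K_len + (K_pow + (K_load + (K_scan + (K_ans + 1 + 1) + 1) + 1) + 1) + 1) + 1,
    fun n G k => ?_⟩
  set B := valueBound n k with hB
  have hB1 : 1 ≤ B := pow_le_valueBound n (k := k) (e := 0) (by omega)
  have hnB : n ≤ B := (Nat.le_succ n).trans (Nat.le_mul_of_pos_right _ (by positivity))
  have hpB : 2 ^ (14 * k) ≤ B := pow_le_valueBound n le_rfl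
  have hkB : 14 * k ≤ B := Nat.lt_two_pow_self.le.trans hpB
  obtain ⟨m₁, hm₁⟩ : ∃ m₁, m₁ = greedyMem (((input G k).mem, n), k) (n * n) := ⟨_, rfl⟩
  obtain ⟨e, he⟩ : ∃ e, e = codeLength m₁ n k := ⟨_, rfl⟩
  obtain ⟨m₂, hm₂⟩ : ∃ m₂, m₂ = powMem (((m₁, n), k), e) (e + 1) := ⟨_, rfl⟩
  obtain ⟨m₃, hm₃⟩ : ∃ m₃, m₃ = scanMem ((((m₂, n), k), e), 2 ^ e) ((n + 1) * codes n (2 ^ e)) :=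
    ⟨_, rfl⟩
  have hek : e ≤ 14 * k := he ▸ codeLength_le _ _ _
  have hkB' : k ≤ B := by omega
  have heB' : e ≤ B := hek.trans hkB
  have heB : 2 ^ e ≤ B := pow_le_valueBound n hek
  have hg : ∀ i j, greedyMem (((input G k).mem, n), k) i j ≤ B := fun i j =>
    greedyMem_le _ hB1 (fun j => (input_mem_le G k j).trans hB1) i j
  have hm₁B : ∀ j, m₁ j ≤ B := fun j => hm₁ ▸ hg _ j
  have hp : ∀ i j, i ≤ e + 1 → powMem (((m₁, n), k), e) i j ≤ B := fun i j hi =>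
    powMem_le _ heB hm₁B i j hi
  have hm₂B : ∀ j, m₂ j ≤ B := fun j => hm₂ ▸ hp _ j le_rfl
  have hs : ∀ i j, scanMem ((((m₂, n), k), e), 2 ^ e) i j ≤ B := fun i j =>
    scanMem_le _ hB1 hm₂B i j
  have hm₃B : ∀ j, m₃ j ≤ B := fun j => hm₃ ▸ hs _ j
  have hN : m₂ (2 * (n * n) + e) = 2 ^ e := hm₂ ▸ powMem_eq (((m₁, n), k), e) e _ (by omega)
  have hfinal : answer m₃ n k (2 ^ e) (scanBase n e) = 1 ∧ IsYes G k ∨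
      answer m₃ n k (2 ^ e) (scanBase n e) = 0 ∧ ¬ IsYes G k := by
    rw [← accepts_iff G k hm₁ he hm₂, ← hm₃, answer]
    split_ifs with h <;> simp [h]
  have hd₂ : ∀ s : State, Ctx.dec l₂ s = ((s.mem, s.reg 0), s.reg 1) := fun s => rfl
  have hd₃ : ∀ s : State, Ctx.dec l₃ s = (((s.mem, s.reg 0), s.reg 1), s.reg 2) := fun s => rfl
  have hd₄ : ∀ s : State, Ctx.dec l₄ s =
      ((((s.mem, s.reg 0), s.reg 1), s.reg 2), s.reg 3) := fun s => rfl
  let Post : State → Prop := fun s =>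
    (IsYes G k → s.reg 0 = 1) ∧ (¬ IsYes G k → s.reg 0 = 0)
  have run_answer : ∀ s : State, s.mem = m₃ → s.reg 0 = n → s.reg 1 = k → s.reg 2 = e →
      s.reg 3 = 2 ^ e → Runs (.seq p_ans (.copy 0 4)) s ((B + 2) ^ (K_ans + 1 + 1)) Post := by
    intro s e0 e1 e2 e3 e4
    have h := h_ans s B
    rw [hd₄, e0, e1, e2, e3, e4] at h
    refine ((h ⟨⟨⟨⟨hm₃B, hnB⟩, hkB'⟩, heB'⟩, heB⟩).seq fun s' ⟨_, _, h'⟩ =>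
      Runs.copy ?_).mono (add_le_pow le_rfl (le_two_pow_add B 1)) fun _ h => h
    change s'.reg 4 = answer m₃ n k (2 ^ e) (scanBase n e) at h'
    simp only [Post, State.setReg_reg, if_true, h']
    rcases hfinal with ⟨f1, f2⟩ | ⟨f1, f2⟩ <;> simp [f1, f2]
  have run_scan : ∀ s : State, s.mem = m₂ → s.reg 0 = n → s.reg 1 = k → s.reg 2 = e →
      s.reg 3 = 2 ^ e → Runs (.seq p_scan (.seq p_ans (.copy 0 4))) s
        ((B + 2) ^ (K_scan + (K_ans + 1 + 1) + 1)) Post := by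
    intro s e0 e1 e2 e3 e4
    have h := h_scan s B
    rw [hd₄, e0, e1, e2, e3, e4] at h
    refine (Runs.seq (h fun i _ => ⟨⟨⟨⟨hs i, hnB⟩, hkB'⟩, heB'⟩, heB⟩)
      fun s' ⟨f1, f2⟩ => ?_).mono (add_le_pow le_rfl le_rfl) fun _ h => h
    exact run_answer s' (f2.trans hm₃.symm) (by rw [f1 0 (by omega), e1]) (by rw [f1 1 (by omega), e2])
      (by rw [f1 2 (by omega), e3]) (by rw [f1 3 (by omega), e4])
  have run_load : ∀ s : State, s.mem = m₂ → s.reg 0 = n → s.reg 1 = k → s.reg 2 = e →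
      Runs (.seq p_load (.seq p_scan (.seq p_ans (.copy 0 4)))) s
        ((B + 2) ^ (K_load + (K_scan + (K_ans + 1 + 1) + 1) + 1)) Post := by
    intro s e0 e1 e2 e3
    have h := h_load s B
    rw [hd₃, e0, e1, e2, e3] at h
    refine (Runs.seq (h ⟨⟨⟨hm₂B, hnB⟩, hkB'⟩, heB'⟩)
      fun s' ⟨f0, f1, f2⟩ => ?_).mono (add_le_pow le_rfl le_rfl) fun _ h => h
    exact run_scan s' f0 (by rw [f1 0 (by omega), e1]) (by rw [f1 1 (by omega), e2])
      (by rw [f1 2 (by omega), e3]) (f2.trans hN)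
  have run_pow : ∀ s : State, s.mem = m₁ → s.reg 0 = n → s.reg 1 = k → s.reg 2 = e →
      Runs (.seq p_pow (.seq p_load (.seq p_scan (.seq p_ans (.copy 0 4))))) s
        ((B + 2) ^ (K_pow + (K_load + (K_scan + (K_ans + 1 + 1) + 1) + 1) + 1)) Post := by
    intro s e0 e1 e2 e3
    have h := h_pow s B
    rw [hd₃, e0, e1, e2, e3] at h
    refine (Runs.seq (h fun i hi => ⟨⟨⟨fun j => hp i j hi, hnB⟩, hkB'⟩, heB'⟩)
      fun s' ⟨f1, f2⟩ => ?_).mono (add_le_pow le_rfl le_rfl) fun _ h => h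
    exact run_load s' (f2.trans hm₂.symm) (by rw [f1 0 (by omega), e1]) (by rw [f1 1 (by omega), e2])
      (by rw [f1 2 (by omega), e3])
  have run_length : ∀ s : State, s.mem = m₁ → s.reg 0 = n → s.reg 1 = k →
      Runs (.seq p_len (.seq p_pow (.seq p_load (.seq p_scan (.seq p_ans (.copy 0 4)))))) s
        ((B + 2) ^ (K_len + (K_pow + (K_load + (K_scan + (K_ans + 1 + 1) + 1) + 1) + 1) + 1)) Post := by
    intro s e0 e1 e2
    have h := h_len s B
    rw [hd₂, e0, e1, e2] at h
    refine (Runs.seq (h ⟨⟨hm₁B, hnB⟩, hkB'⟩)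
      fun s' ⟨f0, f1, f2⟩ => ?_).mono (add_le_pow le_rfl le_rfl) fun _ h => h
    exact run_pow s' f0 (by rw [f1 0 (by omega), e1]) (by rw [f1 1 (by omega), e2])
      (f2.trans he.symm)
  have h := h_greedy (input G k) B
  rw [hd₂, show (input G k).reg 0 = n from rfl, show (input G k).reg 1 = k from rfl] at h
  refine (Runs.seq (h fun i _ => ⟨⟨hg i, hnB⟩, hkB'⟩)
    fun s' ⟨f1, f2⟩ => ?_).mono (add_le_pow le_rfl le_rfl) fun _ h => h
  exact run_length s' (f2.trans hm₁.symm) (f1 0 (by omega)) (f1 1 (by omega))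

/-- As `valueBound n k` is at least `1`, adding `2` costs at most a factor `3`. The constant `14 * K
+ 3 ^ K` dominates at once the exponent `14 * K`, the factor `3 ^ K` and the exponent `K`. -/
theorem valueBound_pow_le (n k K : ℕ) : (valueBound n k + 2) ^ K ≤
    2 ^ ((14 * K + 3 ^ K) * k) * ((14 * K + 3 ^ K) * (n + 1) ^ (14 * K + 3 ^ K)) := by
  have h1 : 1 ≤ valueBound n k := pow_le_valueBound n (k := k) (e := 0) (by omega)
  calc (valueBound n k + 2) ^ K ≤ (3 * valueBound n k) ^ K := Nat.pow_le_pow_left (by omega) _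
    _ = 2 ^ (14 * K * k) * (3 ^ K * (n + 1) ^ K) := by
      rw [valueBound, mul_pow, mul_pow, ← pow_mul]
      ring_nf
    _ ≤ _ := by
      have h2 : K ≤ 14 * K + 3 ^ K := (Nat.le_mul_of_pos_left K (by omega)).trans
        (Nat.le_add_right _ _)
      exact Nat.mul_le_mul
        (Nat.pow_le_pow_right (by omega) (Nat.mul_le_mul_right _ (Nat.le_add_right _ _)))
        (Nat.mul_le_mul (Nat.le_add_left _ _) (Nat.pow_le_pow_right (by omega) h2))

theorem exists_solvesInTime : ∃ (p : Prog) (c : ℕ),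
    SolvesInTime p (fun n k => 2 ^ (c * k) * (c * (n + 1) ^ c)) := by
  obtain ⟨p, K, h⟩ := exists_program
  refine ⟨p, 14 * K + 3 ^ K, fun n G k => ?_⟩
  obtain ⟨t, s, h1, h2, h3⟩ := h n G k
  exact ⟨t, s, h1, h2.trans (valueBound_pow_le n k K), h3⟩

end UpperEDS

theorem mainTheorem3 :
    (∃ (p : UpperEDS.Prog) (c : ℕ),
      UpperEDS.SolvesInTime p (fun n k => 2 ^ (c * k) * (c * (n + 1) ^ c))) ∧
    (∀ (n : ℕ) (G : SimpleGraph (Fin n)) (k : ℕ) (M : G.Subgraph),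
      Maximal (fun M' : G.Subgraph => M'.IsMatching) M →
        UpperEDS.IsMinimalEdgeDominating G M.edgeSet ∧
        (k ≤ M.edgeSet.ncard → UpperEDS.IsYes G k) ∧
        (M.edgeSet.ncard < k →
          G.IsVertexCover M.verts ∧ (M.verts.ncard : ℤ) ≤ 2 * (k : ℤ) - 2 ∧
          ∃ (m : ℕ) (D : UpperEDS.TreeDecomposition G (Fin m)),
            D.WidthLE (2 * (k : ℤ) - 1))) :=
  ⟨UpperEDS.exists_solvesInTime, fun _ => UpperEDS.maximal_matching_dichotomy⟩
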